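/- Let $F:\mathbf{CP}^2\to\Delta=\{x\in\mathbf R^3 : x_i\ge 0,\ x_0+x_1+x_2=1\}$, $F([z_0:z_1:z_2])=\bigl(|z_0|^2,|z_1|^2,|z_2|^2\bigr)/\sum_j|z_j|^2$, be the standard moment map, and let $d\ge 1$. For a homogeneous polynomial $p=\sum_{|I|=d}a_Iz^I$ with complex coefficients, where $I\in\mathbf Z_{\ge0}^3$ and $|I|=i_0+i_1+i_2$, let $C_p=\{p=0\}\subset\mathbf{CP}^2$. The holes of $F(C_p)$ are the bounded connected components of its complement in the plane $\{x\in\mathbf R^3: x_0+x_1+x_2=1\}$. A simplicial decomposition $Z$ of the Newton polygon $N=\{x\in\mathbf R^3:x_i\ge 0,\ x_0+x_1+x_2=d\}$ means one whose vertices are exactly all lattice points of $N$. A function $w$ on the lattice points of $N$ is strictly convex with respect to $Z$, respectively strictly convex with margin at least $R>0$, if for every triangle $s$ of $Z$ there is an affine function $\ell$ on $N$ with $\ell=w$ at the vertices of $s$ and $\ell<w$, respectively $\ell+R\le w$, at all other lattice points of $N$. Say that $p$ (or $C_p$) is $R$-near the large complex limit if all $a_I$ with $|I|=d$ are nonzero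 and the function $I\mapsto-\log|a_I|$ is strictly convex with margin at least $R$ with respect to some such $Z$. 1. There is $R>0$ depending only on $d$ such that, for every degree-$d$ curve $C_p$ that is $R$-near the large complex limit, $F(C_p)$ has exactly $g=\frac{(d-1)(d-2)}2$ holes and meets each of the three edges of $\Delta$ in exactly $d$ points. 2. In particular, for every $Z$ as above, every $w$ strictly convex with respect to $Z$ and all nonzero complex constants $c_I$, there is $t_0>0$ such that for all $0<t<t_0$ the image $F(C_{p_t})$ of the curve defined by $p_t=\sum_{|I|=d}c_It^{w_I}z^I$ has exactly $g$ holes and meets each edge of $\Delta$ in exactly $d$ points. -/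

import Mathlib

open scoped LinearAlgebra.Projectivization

noncomputable section

namespace AmoebaLCL

/-- The standard moment map `F : ℂP² → ℝ³` for the Fubini-Study metric,
`[z₀ : z₁ : z₂] ↦ (|z₀|², |z₁|², |z₂|²) / (|z₀|² + |z₁|² + |z₂|²)`. Its image is the simplex
`Δ = {x | 0 ≤ xᵢ, x₀ + x₁ + x₂ = 1}`. -/
def momentMap : ℙ ℂ (Fin 3 → ℂ) → (Fin 3 → ℝ) :=
  Projectivization.lift (fun z i => ‖z.1 i‖ ^ 2 / ∑ j, ‖z.1 j‖ ^ 2) (by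
    rintro ⟨a, ha⟩ ⟨b, hb⟩ t (h : a = t • b)
    have ht : t ≠ 0 := by
      rintro rfl
      exact ha (by simp [h])
    have ht' : ‖t‖ ^ 2 ≠ 0 := pow_ne_zero 2 (norm_ne_zero_iff.mpr ht)
    funext i
    subst h
    simp only [Pi.smul_apply, smul_eq_mul, norm_mul, mul_pow, ← Finset.mul_sum]
    exact mul_div_mul_left _ _ ht')

/-- The plane curve `C_p = {p = 0} ⊆ ℂP²` of a homogeneous polynomial `p`. -/
def planeCurve (p : MvPolynomial (Fin 3) ℂ) : Set (ℙ ℂ (Fin 3 → ℂ)) :=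
  {x | ∃ (z : Fin 3 → ℂ) (hz : z ≠ 0),
    x = Projectivization.mk ℂ z hz ∧ MvPolynomial.eval z p = 0}

/-- The image `F(C_p)` of the curve under the moment map. -/
def amoeba (p : MvPolynomial (Fin 3) ℂ) : Set (Fin 3 → ℝ) :=
  momentMap '' planeCurve p

/-- The affine plane spanned by the moment simplex. -/
def simplexPlane : Set (Fin 3 → ℝ) := {x | ∑ i, x i = 1}

/-- The edge of the moment simplex `Δ` on which the `i`-th coordinate vanishes. -/
def edge (i : Fin 3) : Set (Fin 3 → ℝ) := {x | x ∈ stdSimplex ℝ (Fin 3) ∧ x i = 0}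

/-- The holes of a subset `A` of the plane spanned by `Δ`: the bounded connected components of
the complement of `A` in that plane. -/
def holes (A : Set (Fin 3 → ℝ)) : Set (Set (Fin 3 → ℝ)) :=
  {U | (∃ x ∈ simplexPlane \ A, U = connectedComponentIn (simplexPlane \ A) x) ∧
    Bornology.IsBounded U}

/-- The exponent `I` as a point of `ℝ³`. -/
def latticePoint (I : Fin 3 →₀ ℕ) : Fin 3 → ℝ := fun i => (I i : ℝ)

/-- `Z` is a simplicial decomposition of the Newton polygon `{x | 0 ≤ xᵢ, x₀ + x₁ + x₂ = d}` of
degree `d` polynomials, whose vertices are all the lattice points of the polygon. -/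
structure IsNewtonTriangulation (d : ℕ) (Z : Geometry.SimplicialComplex ℝ (Fin 3 → ℝ)) :
    Prop where
  space_eq : Z.space = {x | (∀ i, 0 ≤ x i) ∧ ∑ i, x i = (d : ℝ)}
  vertices_eq : Z.vertices = {x | ∃ I : Fin 3 →₀ ℕ, I.degree = d ∧ x = latticePoint I}

/-- The convexity condition `Z` on a weight function `w` on exponents of degree `d`: `w` is
strictly convex with respect to `Z`, i.e. on every triangle `s` of `Z`, `w` agrees with a linear
form of `ℝ³` that is smaller than `w` at all lattice points outside `s`. (On the plane
`x₀ + x₁ + x₂ = d` with `d ≥ 1` every affine function is the restriction of a linear form.) -/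
def IsStrictlyConvexFor (d : ℕ) (Z : Geometry.SimplicialComplex ℝ (Fin 3 → ℝ))
    (w : (Fin 3 →₀ ℕ) → ℝ) : Prop :=
  ∀ s ∈ Z.facets, ∃ l : (Fin 3 → ℝ) →ₗ[ℝ] ℝ, ∀ I : Fin 3 →₀ ℕ, I.degree = d →
    (latticePoint I ∈ s → l (latticePoint I) = w I) ∧
    (latticePoint I ∉ s → l (latticePoint I) < w I)

/-- The quantitative version: strict convexity with respect to `Z` with margin at least `R`. -/
def IsStrictlyConvexForWithMargin (d : ℕ) (Z : Geometry.SimplicialComplex ℝ (Fin 3 → ℝ))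
    (R : ℝ) (w : (Fin 3 →₀ ℕ) → ℝ) : Prop :=
  ∀ s ∈ Z.facets, ∃ l : (Fin 3 → ℝ) →ₗ[ℝ] ℝ, ∀ I : Fin 3 →₀ ℕ, I.degree = d →
    (latticePoint I ∈ s → l (latticePoint I) = w I) ∧
    (latticePoint I ∉ s → l (latticePoint I) + R ≤ w I)

/-- The `R`-neighbourhood of the large complex limit, in the space of degree `d` polynomials:
all the coefficients `a_I` are nonzero, and the weights `-log |a_I|` are strictly convex with
margin at least `R` with respect to some simplicial decomposition of the Newton polygon. -/
def IsNearLargeComplexLimit (d : ℕ) (R : ℝ) (p : MvPolynomial (Fin 3) ℂ) : Prop :=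
  p.IsHomogeneous d ∧
  (∀ I : Fin 3 →₀ ℕ, I.degree = d → p.coeff I ≠ 0) ∧
  ∃ Z, IsNewtonTriangulation d Z ∧
    IsStrictlyConvexForWithMargin d Z R (fun I => -Real.log ‖p.coeff I‖)

/-- The polynomial `∑_{|I| = d} c_I t^{w_I} z^I`. -/
def weightedPoly (d : ℕ) (c : (Fin 3 →₀ ℕ) → ℂ) (w : (Fin 3 →₀ ℕ) → ℝ) (t : ℝ) :
    MvPolynomial (Fin 3) ℂ :=
  ∑ I ∈ Finset.finsuppAntidiag (Finset.univ : Finset (Fin 3)) d,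
    MvPolynomial.monomial I (c I * ((t ^ w I : ℝ) : ℂ))

/-- The image of the curve has exactly `(d - 1)(d - 2) / 2` holes and meets each edge of `Δ` in
exactly `d` points. Here `d ≥ 1`. -/
def HasExpectedAmoeba (d : ℕ) (p : MvPolynomial (Fin 3) ℂ) : Prop :=
  (holes (amoeba p)).encard = (((d - 1) * (d - 2) / 2 : ℕ) : ℕ∞) ∧
  ∀ i : Fin 3, (amoeba p ∩ edge i).encard = (d : ℕ∞)

end AmoebaLCL

end

/-! A point of `Δ` with radii `r` lies off the amoeba exactly when `p` has no zero on the torus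
`|z_i| = r_i`. On such a torus the winding numbers of `p` along the three coordinate loops form the
order, a vector of natural numbers with sum `d` that is locally constant off the amoeba. Where the
term of exponent `I` exceeds the sum of all the others in absolute value, Rouché gives order `I`.
Both claims follow once every `I` of degree `d` dominates somewhere
(`hasExpectedAmoeba_of_nonempty`).

In logarithmic coordinates the dominance region of `I` is convex, so it lies in a single component.
Any other point of order `I` with positive coordinates is joined to it along `s ↦ (r_j s ^ k_j)`:
the one-variable polynomial `p(c_j w ^ k_j)` has `∑ k_j I_j` roots in both the initial and the final
disc, hence none between them (`nonvanishingOnTorus_of_order`). The initial count needs additivity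
of the order in `k` (`order_eq_sum`). If all `I_j` are positive, the component cannot touch an edge,
where some order is zero, so it is a hole. If `I_i = 0`, the term still dominates as `r_i` shrinks
to `0`, and the component escapes across that edge. Holes thus correspond to interior lattice
points. On an edge, dominance yields discs with exactly `0, 1, ..., d` roots, which separates the
moduli of the `d` roots.

Dominance comes from convexity: the affine function supporting the weights on a triangle at `I` is
tilted so that it touches them at `I` only, and its coefficients are the logarithmic radii. -/

namespace AmoebaLCL

/-! ### Argument principle and Rouché's theorem for polynomials -/

/-- The integral of `1 / (z - a)` over a circle that encloses `a`, or does not. -/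
theorem circleIntegral_inv_sub {ρ : ℝ} (hρ : 0 < ρ) {a : ℂ} (ha : ‖a‖ ≠ ρ) :
    (∮ z in C(0, ρ), 1 / (z - a)) = if ‖a‖ < ρ then 2 * Real.pi * Complex.I else 0 := by
  simp only [one_div]
  split_ifs with h
  · exact circleIntegral.integral_sub_inv_of_mem_ball (by simpa using h)
  · have h' : ρ < ‖a‖ := lt_of_le_of_ne (not_lt.mp h) (Ne.symm ha)
    have hne : ∀ z ∈ Metric.closedBall (0 : ℂ) ρ, z - a ≠ 0 := by
      intro z hz hza
      rw [sub_eq_zero] at hza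
      subst hza
      simp at hz
      linarith
    refine Complex.circleIntegral_eq_zero_of_differentiable_on_off_countable hρ.le
      Set.countable_empty (ContinuousOn.inv₀ (by fun_prop) hne) ?_
    intro z hz
    exact (by fun_prop : DifferentiableAt ℂ (fun z => z - a) z).inv
      (hne z (Metric.ball_subset_closedBall hz.1))

/-- The number of roots, with multiplicity, in the open disc of radius `ρ`. -/
noncomputable def rootCount (f : Polynomial ℂ) (ρ : ℝ) : ℕ := (f.roots.filter (fun r => ‖r‖ < ρ)).card

/-- The argument principle for polynomials. -/
theorem circleIntegral_derivative_div (f : Polynomial ℂ) {ρ : ℝ} (hρ : 0 < ρ)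
    (hf : ∀ w : ℂ, ‖w‖ = ρ → f.eval w ≠ 0) :
    (∮ z in C(0, ρ), f.derivative.eval z / f.eval z) =
      2 * Real.pi * Complex.I * rootCount f ρ := by
  have hroot : ∀ a ∈ f.roots, ‖a‖ ≠ ρ := fun a ha h => hf a h (Polynomial.isRoot_of_mem_roots ha)
  have h1 : (∮ z in C(0, ρ), f.derivative.eval z / f.eval z) =
      ∮ z in C(0, ρ), (f.roots.map fun a => 1 / (z - a)).sum := by
    refine circleIntegral.integral_congr hρ.le fun z hz => ?_
    exact (IsAlgClosed.splits f).eval_derivative_div_eval_of_ne_zero (hf z (by simpa using hz))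
  rw [h1, rootCount]
  have key : ∀ s : Multiset ℂ, (∀ a ∈ s, ‖a‖ ≠ ρ) →
      CircleIntegrable (fun z => (s.map fun a => 1 / (z - a)).sum) 0 ρ ∧
      (∮ z in C(0, ρ), (s.map fun a => 1 / (z - a)).sum) =
        2 * Real.pi * Complex.I * ((s.filter (fun r => ‖r‖ < ρ)).card : ℂ) := by
    intro s
    induction s using Multiset.induction_on with
    | empty => intro _; simp [circleIntegral]
    | cons a s ih =>
      intro hs
      obtain ⟨i1, i2⟩ := ih fun b hb => hs b (Multiset.mem_cons_of_mem hb)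
      have ha := hs a (Multiset.mem_cons_self a s)
      have i3 : CircleIntegrable (fun z => 1 / (z - a)) 0 ρ := by
        refine ContinuousOn.circleIntegrable hρ.le (continuousOn_const.div (by fun_prop) ?_)
        intro z hz hza
        rw [sub_eq_zero] at hza
        subst hza
        exact ha (by simpa using hz)
      simp only [Multiset.map_cons, Multiset.sum_cons]
      refine ⟨i3.add i1, ?_⟩
      rw [circleIntegral.integral_add i3 i1, i2, circleIntegral_inv_sub hρ ha]
      by_cases h : ‖a‖ < ρ
      · rw [if_pos h, Multiset.filter_cons_of_pos (p := fun r : ℂ => ‖r‖ < ρ) s h,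
          Multiset.card_cons]
        push_cast
        ring
      · rw [if_neg h, Multiset.filter_cons_of_neg (p := fun r : ℂ => ‖r‖ < ρ) s h, zero_add]
  exact (key f.roots hroot).2

/-- The argument principle for polynomials, as an integral over the angle. -/
theorem integral_logDeriv (f : Polynomial ℂ) {ρ : ℝ} (hρ : 0 < ρ)
    (hf : ∀ w : ℂ, ‖w‖ = ρ → f.eval w ≠ 0) :
    (∫ θ in (0 : ℝ)..2 * Real.pi, circleMap 0 ρ θ * f.derivative.eval (circleMap 0 ρ θ) /
      f.eval (circleMap 0 ρ θ)) = 2 * Real.pi * rootCount f ρ := by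
  have h := circleIntegral_derivative_div f hρ hf
  simp only [circleIntegral, deriv_circleMap, smul_eq_mul] at h
  have h2 : (∫ θ in (0 : ℝ)..2 * Real.pi, circleMap 0 ρ θ * Complex.I *
      (f.derivative.eval (circleMap 0 ρ θ) / f.eval (circleMap 0 ρ θ))) =
      Complex.I * ∫ θ in (0 : ℝ)..2 * Real.pi, circleMap 0 ρ θ *
        f.derivative.eval (circleMap 0 ρ θ) / f.eval (circleMap 0 ρ θ) := by
    rw [← intervalIntegral.integral_const_mul]
    congr 1
    ext θ
    ring
  rw [h2] at h
  apply mul_left_cancel₀ Complex.I_ne_zero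
  rw [h]
  ring

/-- The number of roots in a disc is continuous in families without roots on the circle. -/
theorem continuous_rootCount {X : Type*} [TopologicalSpace X]
    (f : X → Polynomial ℂ) {ρ : ℝ} (hρ : 0 < ρ)
    (h0 : Continuous fun y : X × ℂ => (f y.1).eval y.2)
    (h1 : Continuous fun y : X × ℂ => (f y.1).derivative.eval y.2)
    (hf : ∀ x, ∀ w : ℂ, ‖w‖ = ρ → (f x).eval w ≠ 0) :
    Continuous fun x => rootCount (f x) ρ := by
  -- Continuity into the discrete space `ℕ` can be tested in `ℝ`, where the count is an integral
  -- depending continuously on the parameter.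
  rw [Nat.isClosedEmbedding_coe_real.isInducing.continuous_iff]
  have h2 : ∀ x, ((rootCount (f x) ρ : ℕ) : ℝ) =
      ((2 * Real.pi : ℂ)⁻¹ * ∫ θ in (0 : ℝ)..2 * Real.pi, circleMap 0 ρ θ *
        (f x).derivative.eval (circleMap 0 ρ θ) / (f x).eval (circleMap 0 ρ θ)).re := by
    intro x
    rw [integral_logDeriv (f x) hρ (hf x), inv_mul_cancel_left₀, Complex.natCast_re]
    simp [Real.pi_ne_zero]
  have h3 : Continuous fun x => ((rootCount (f x) ρ : ℕ) : ℝ) := by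
    simp only [h2]
    refine Complex.continuous_re.comp (continuous_const.mul ?_)
    refine intervalIntegral.continuous_parametric_intervalIntegral_of_continuous' ?_ _ _
    have hc : Continuous fun y : X × ℝ => ((y.1, circleMap 0 ρ y.2) : X × ℂ) := by
      have := continuous_circleMap 0 ρ
      fun_prop
    refine Continuous.div ?_ (h0.comp hc) ?_
    · exact ((continuous_circleMap 0 ρ).comp continuous_snd).mul (h1.comp hc)
    · rintro ⟨x, θ⟩
      exact hf x _ (by simp [abs_of_pos hρ])
  exact h3

/-- Rouché's theorem for polynomials. -/
theorem rootCount_eq_of_norm_sub_lt (f g : Polynomial ℂ) {ρ : ℝ} (hρ : 0 < ρ)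
    (h : ∀ w : ℂ, ‖w‖ = ρ → ‖f.eval w - g.eval w‖ < ‖g.eval w‖) :
    rootCount f ρ = rootCount g ρ := by
  -- The segment from `g` to `f` has no zeros on the circle, so the count is constant along it.
  let F : Set.Icc (0 : ℝ) 1 → Polynomial ℂ := fun s => g + Polynomial.C ((s : ℝ) : ℂ) * (f - g)
  have hF : Continuous fun x => rootCount (F x) ρ := by
    refine continuous_rootCount F hρ ?_ ?_ ?_
    · simp only [F, Polynomial.eval_add, Polynomial.eval_mul, Polynomial.eval_C,
        Polynomial.eval_sub]
      fun_prop
    · simp only [F, Polynomial.eval_add, Polynomial.eval_mul, Polynomial.eval_C,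
        Polynomial.eval_sub, Polynomial.derivative_add, Polynomial.derivative_C_mul,
        Polynomial.derivative_sub]
      fun_prop
    · intro s w hw h0
      simp only [F, Polynomial.eval_add, Polynomial.eval_mul, Polynomial.eval_C,
        Polynomial.eval_sub] at h0
      have h1 := h w hw
      have h2 : g.eval w = -(((s : ℝ) : ℂ) * (f.eval w - g.eval w)) :=
        eq_neg_of_add_eq_zero_left h0
      have h3 : ‖g.eval w‖ ≤ ‖f.eval w - g.eval w‖ := by
        rw [h2, norm_neg, norm_mul, Complex.norm_real, Real.norm_of_nonneg s.2.1, ← h2]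
        exact mul_le_of_le_one_left (norm_nonneg _) s.2.2
      linarith
  have := PreconnectedSpace.constant (inferInstance : PreconnectedSpace (Set.Icc (0 : ℝ) 1)) hF
    (x := ⟨1, by simp⟩) (y := ⟨0, by simp⟩)
  simpa [F] using this

theorem rootCount_monomial {a : ℂ} (ha : a ≠ 0) (n : ℕ) {ρ : ℝ} (hρ : 0 < ρ) :
    rootCount (Polynomial.C a * Polynomial.X ^ n) ρ = n := by
  have h0 : ∀ b ∈ n • ({0} : Multiset ℂ), ‖b‖ < ρ := by
    intro b hb
    have : b = 0 := by simpa using Multiset.mem_of_mem_nsmul hb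
    simpa [this] using hρ
  rw [rootCount, Polynomial.roots_C_mul_X_pow ha, Multiset.filter_eq_self.mpr h0]
  simp

/-! ### Winding numbers of `p` on tori -/

/-- The restriction of `p` to the monomial curve `w ↦ (c_j w ^ k_j)_j`. -/
noncomputable def curvePoly (p : MvPolynomial (Fin 3) ℂ) (c : Fin 3 → ℂ) (k : Fin 3 → ℕ) :
    Polynomial ℂ :=
  MvPolynomial.aeval (fun j => Polynomial.C (c j) * Polynomial.X ^ k j) p

theorem eval_curvePoly (p : MvPolynomial (Fin 3) ℂ) (c : Fin 3 → ℂ) (k : Fin 3 → ℕ) (w : ℂ) :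
    (curvePoly p c k).eval w = MvPolynomial.eval (fun j => c j * w ^ k j) p := by
  induction p using MvPolynomial.induction_on with
  | C a => simp [curvePoly]
  | add p q hp hq =>
    have h : curvePoly (p + q) c k = curvePoly p c k + curvePoly q c k := by simp [curvePoly]
    rw [h, Polynomial.eval_add, hp, hq, map_add]
  | mul_X p i hp =>
    have h : curvePoly (p * MvPolynomial.X i) c k =
        curvePoly p c k * (Polynomial.C (c i) * Polynomial.X ^ k i) := by simp [curvePoly]
    rw [h, Polynomial.eval_mul, hp, map_mul]
    simp

theorem eval_derivative_curvePoly (p : MvPolynomial (Fin 3) ℂ) (c : Fin 3 → ℂ) (k : Fin 3 → ℕ)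
    (w : ℂ) : (curvePoly p c k).derivative.eval w =
      ∑ j, k j * (c j * w ^ (k j - 1)) *
        MvPolynomial.eval (fun j => c j * w ^ k j) (MvPolynomial.pderiv j p) := by
  induction p using MvPolynomial.induction_on with
  | C a => simp [curvePoly]
  | add p q hp hq =>
    have h : curvePoly (p + q) c k = curvePoly p c k + curvePoly q c k := by simp [curvePoly]
    rw [h, Polynomial.derivative_add, Polynomial.eval_add, hp, hq, ← Finset.sum_add_distrib]
    refine Finset.sum_congr rfl fun j _ => ?_
    rw [map_add, map_add]
    ring
  | mul_X p i hp =>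
    have h : curvePoly (p * MvPolynomial.X i) c k =
        curvePoly p c k * (Polynomial.C (c i) * Polynomial.X ^ k i) := by simp [curvePoly]
    rw [h, Polynomial.derivative_mul, Polynomial.eval_add, Polynomial.eval_mul, hp,
      Polynomial.eval_mul, Polynomial.eval_mul (p := curvePoly p c k), eval_curvePoly]
    simp only [Derivation.leibniz, MvPolynomial.pderiv_X, smul_eq_mul, map_add, map_mul,
      MvPolynomial.eval_X, mul_add, Finset.sum_add_distrib]
    rw [add_comm, Finset.sum_mul]
    congr 1
    · rw [Finset.sum_eq_single i (by intro b _ hb; simp [Pi.single_eq_of_ne' hb]) (by simp)]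
      simp only [Pi.single_eq_same, map_one, Polynomial.derivative_C_mul_X_pow,
        Polynomial.eval_mul, Polynomial.eval_C, Polynomial.eval_pow, Polynomial.eval_X]
      ring
    · refine Finset.sum_congr rfl fun j _ => ?_
      simp
      ring

/-- `p` has no zeros on the torus of radii `r`. -/
def NonvanishingOnTorus (p : MvPolynomial (Fin 3) ℂ) (r : Fin 3 → ℝ) : Prop :=
  ∀ z : Fin 3 → ℂ, (∀ i, ‖z i‖ = r i) → MvPolynomial.eval z p ≠ 0

/-- The winding number of `p` along the loop `w ↦ (c_j w ^ k_j)_j`, `|w| = 1`. -/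
noncomputable def order (p : MvPolynomial (Fin 3) ℂ) (c : Fin 3 → ℂ) (k : Fin 3 → ℕ) : ℕ :=
  rootCount (curvePoly p c k) 1

theorem continuous_eval_curvePoly (p : MvPolynomial (Fin 3) ℂ) (k : Fin 3 → ℕ) :
    Continuous fun y : (Fin 3 → ℂ) × ℂ => (curvePoly p y.1 k).eval y.2 := by
  simp only [eval_curvePoly]
  exact (MvPolynomial.continuous_eval p).comp (by fun_prop)

theorem continuous_eval_derivative_curvePoly (p : MvPolynomial (Fin 3) ℂ) (k : Fin 3 → ℕ) :
    Continuous fun y : (Fin 3 → ℂ) × ℂ => (curvePoly p y.1 k).derivative.eval y.2 := by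
  simp only [eval_derivative_curvePoly]
  refine continuous_finsetSum _ fun j _ => Continuous.mul (by fun_prop) ?_
  exact (MvPolynomial.continuous_eval _).comp (by fun_prop)

theorem NonvanishingOnTorus.eval_curvePoly_ne_zero {p : MvPolynomial (Fin 3) ℂ} {r : Fin 3 → ℝ}
    (h : NonvanishingOnTorus p r) {c : Fin 3 → ℂ} (hc : ∀ i, ‖c i‖ = r i) (k : Fin 3 → ℕ)
    {w : ℂ} (hw : ‖w‖ = 1) : (curvePoly p c k).eval w ≠ 0 := by
  rw [eval_curvePoly]
  exact h _ fun i => by simp [hc, hw]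

theorem continuous_order {X : Type*} [TopologicalSpace X] (p : MvPolynomial (Fin 3) ℂ)
    (k : Fin 3 → ℕ) {c : X → Fin 3 → ℂ} (hc : Continuous c)
    (h : ∀ x, NonvanishingOnTorus p fun i => ‖c x i‖) :
    Continuous fun x => order p (c x) k := by
  refine continuous_rootCount _ one_pos ?_ ?_ fun x w hw =>
    (h x).eval_curvePoly_ne_zero (fun i => rfl) k hw
  · exact (continuous_eval_curvePoly p k).comp
      ((hc.comp continuous_fst).prodMk continuous_snd)
  · exact (continuous_eval_derivative_curvePoly p k).comp
      ((hc.comp continuous_fst).prodMk continuous_snd)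

/-- The order does not depend on the arguments of the base point. -/
theorem order_mul_circle {p : MvPolynomial (Fin 3) ℂ} {c : Fin 3 → ℂ}
    (h : NonvanishingOnTorus p fun i => ‖c i‖) (k : Fin 3 → ℕ) (g : Fin 3 → Circle) :
    order p (fun j => c j * g j) k = order p c k := by
  -- The arguments lift to the connected space `ℝ³`, on which a continuous integer is constant.
  have hcont : Continuous fun θ : Fin 3 → ℝ => order p (fun j => c j * Circle.exp (θ j)) k :=
    continuous_order p k (by fun_prop) fun θ => by simpa using h
  have h2 := PreconnectedSpace.constant inferInstance hcont (x := fun j => (g j : ℂ).arg) (y := 0)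
  simpa using h2

/-- The logarithmic derivative of `p` in the direction `j`. -/
noncomputable def logDerivAt (p : MvPolynomial (Fin 3) ℂ) (j : Fin 3) (z : Fin 3 → ℂ) : ℂ :=
  z j * MvPolynomial.eval z (MvPolynomial.pderiv j p) / MvPolynomial.eval z p

theorem integral_logDerivAt {p : MvPolynomial (Fin 3) ℂ} {c : Fin 3 → ℂ}
    (h : NonvanishingOnTorus p fun i => ‖c i‖) (k : Fin 3 → ℕ) :
    (∫ θ in (0 : ℝ)..2 * Real.pi, ∑ j, k j * logDerivAt p j (fun i => c i * Circle.exp θ ^ k i)) =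
      2 * Real.pi * order p c k := by
  rw [order, ← integral_logDeriv _ one_pos fun w hw => h.eval_curvePoly_ne_zero (fun i => rfl) k hw]
  refine intervalIntegral.integral_congr fun θ _ => ?_
  have hw : (Circle.exp θ : ℂ) = circleMap 0 1 θ := by simp [circleMap, Circle.coe_exp]
  simp only [hw]
  rw [eval_derivative_curvePoly, eval_curvePoly, Finset.mul_sum, Finset.sum_div]
  refine Finset.sum_congr rfl fun j _ => ?_
  rw [logDerivAt, ← mul_div_assoc]
  congr 1
  rcases Nat.eq_zero_or_pos (k j) with h0 | h0
  · simp [h0]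
  · have : circleMap 0 1 θ ^ k j = circleMap 0 1 θ * circleMap 0 1 θ ^ (k j - 1) := by
      rw [← pow_succ', Nat.sub_add_cancel h0]
    rw [this]
    ring

-- The order is the mean of a logarithmic derivative over one loop, and is the same for every
-- rotated base point. Averaging over all rotations and using invariance of `μ` removes the loop,
-- leaving an expression linear in `k`.
open MeasureTheory in
theorem order_eq_integral {p : MvPolynomial (Fin 3) ℂ} {c : Fin 3 → ℂ}
    (h : NonvanishingOnTorus p fun i => ‖c i‖) (k : Fin 3 → ℕ)
    [MeasurableSpace (Fin 3 → Circle)] [BorelSpace (Fin 3 → Circle)]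
    (μ : Measure (Fin 3 → Circle)) [IsProbabilityMeasure μ] [μ.IsMulRightInvariant] :
    (order p c k : ℂ) = ∑ j, k j * ∫ g, logDerivAt p j (fun i => c i * g i) ∂μ := by
  have hcont : ∀ j, Continuous fun g : Fin 3 → Circle => logDerivAt p j fun i => c i * g i := by
    intro j
    refine Continuous.div (Continuous.mul (by fun_prop) ?_) ?_ fun g => h _ fun i => by
      rw [norm_mul, Circle.norm_coe, mul_one]
    · exact (MvPolynomial.continuous_eval _).comp (by fun_prop)
    · exact (MvPolynomial.continuous_eval _).comp (by fun_prop)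
  let H : (Fin 3 → Circle) → ℂ := fun g => ∑ j, k j * logDerivAt p j fun i => c i * g i
  have hH : Continuous H := continuous_finsetSum _ fun j _ => continuous_const.mul (hcont j)
  have hint : ∀ f : (Fin 3 → Circle) → ℂ, Continuous f → Integrable f μ := fun f hf =>
    hf.integrable_of_hasCompactSupport (HasCompactSupport.of_compactSpace f)
  have h1 : ∀ g : Fin 3 → Circle,
      (∫ θ in (0 : ℝ)..2 * Real.pi, H (g * fun i => Circle.exp θ ^ k i)) =
        2 * Real.pi * order p c k := by
    intro g
    rw [← order_mul_circle h k g, ← integral_logDerivAt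
      (by simpa only [norm_mul, Circle.norm_coe, mul_one] using h) k]
    simp [H, mul_assoc]
  have h2 : (∫ θ in (0 : ℝ)..2 * Real.pi, ∫ g, H (g * fun i => Circle.exp θ ^ k i) ∂μ) =
      ∫ g, (∫ θ in (0 : ℝ)..2 * Real.pi, H (g * fun i => Circle.exp θ ^ k i)) ∂μ := by
    refine intervalIntegral_integral_swap ?_
    have hc2 : Continuous fun y : ℝ × (Fin 3 → Circle) =>
        H (y.2 * fun i => Circle.exp y.1 ^ k i) := hH.comp (by fun_prop)
    have h3 : IntegrableOn (fun y : ℝ × (Fin 3 → Circle) =>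
        H (y.2 * fun i => Circle.exp y.1 ^ k i)) (Set.uIcc 0 (2 * Real.pi) ×ˢ Set.univ)
        (volume.prod μ) :=
      hc2.continuousOn.integrableOn_compact (isCompact_uIcc.prod isCompact_univ)
    have h4 := h3.mono_set (Set.prod_mono Set.uIoc_subset_uIcc subset_rfl)
    rw [IntegrableOn, ← Measure.prod_restrict, Measure.restrict_univ] at h4
    exact h4
  simp only [h1, integral_mul_right_eq_self] at h2
  have h5 : (∫ g, H g ∂μ) = ∑ j, k j * ∫ g, logDerivAt p j (fun i => c i * g i) ∂μ := by
    simp only [H]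
    refine (integral_finsetSum _ fun j _ => hint _ (continuous_const.mul (hcont j))).trans ?_
    exact Finset.sum_congr rfl fun j _ => integral_const_mul _ _
  rw [h5] at h2
  rw [integral_const, intervalIntegral.integral_const, probReal_univ, one_smul, sub_zero] at h2
  have h6 : (2 * Real.pi : ℂ) ≠ 0 := by simp [Real.pi_ne_zero]
  apply mul_left_cancel₀ h6
  rw [← h2, Complex.real_smul]
  push_cast
  rfl

/-- The order is additive in the direction of the loop. -/
theorem order_eq_sum {p : MvPolynomial (Fin 3) ℂ} {c : Fin 3 → ℂ}
    (h : NonvanishingOnTorus p fun i => ‖c i‖) (k : Fin 3 → ℕ) :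
    order p c k = ∑ j, k j * order p c (Pi.single j 1) := by
  let : MeasurableSpace (Fin 3 → Circle) := borel _
  have : BorelSpace (Fin 3 → Circle) := ⟨rfl⟩
  let μ : MeasureTheory.Measure (Fin 3 → Circle) := MeasureTheory.Measure.haarMeasure ⊤
  have : MeasureTheory.IsProbabilityMeasure μ := ⟨by
    have := MeasureTheory.Measure.haarMeasure_self (K₀ := (⊤ : TopologicalSpace.PositiveCompacts (Fin 3 → Circle)))
    simpa [μ] using this⟩
  have key := order_eq_integral h k μ
  have h1 : ∀ j, (order p c (Pi.single j 1) : ℂ) =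
      ∫ g, logDerivAt p j (fun i => c i * g i) ∂μ := by
    intro j
    rw [order_eq_integral h _ μ, Finset.sum_eq_single j]
    · simp
    · intro b _ hb
      simp [hb]
    · simp
  simp only [← h1] at key
  exact_mod_cast key

/-! ### The moment map in terms of radii -/

/-- The image under the moment map of the torus of radii `r`. -/
noncomputable def momentPoint (r : Fin 3 → ℝ) : Fin 3 → ℝ := fun i => r i ^ 2 / ∑ j, r j ^ 2

theorem degree_of_mem_support {p : MvPolynomial (Fin 3) ℂ} {d : ℕ} (hp : p.IsHomogeneous d)
    {J : Fin 3 →₀ ℕ} (hJ : J ∈ p.support) : J.degree = d := by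
  rw [Finsupp.degree_eq_weight_one]
  exact hp (MvPolynomial.mem_support_iff.mp hJ)

theorem sum_sq_pos {r : Fin 3 → ℝ} (hr : r ≠ 0) : 0 < ∑ j, r j ^ 2 := by
  obtain ⟨i, hi⟩ := Function.ne_iff.mp hr
  exact Finset.sum_pos' (fun j _ => sq_nonneg _) ⟨i, Finset.mem_univ i, sq_pos_of_ne_zero hi⟩

theorem sum_momentPoint {r : Fin 3 → ℝ} (hr : r ≠ 0) : ∑ i, momentPoint r i = 1 := by
  simp only [momentPoint, ← Finset.sum_div]
  exact div_self (sum_sq_pos hr).ne'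

theorem momentPoint_nonneg (r : Fin 3 → ℝ) (i : Fin 3) : 0 ≤ momentPoint r i :=
  div_nonneg (sq_nonneg _) (Finset.sum_nonneg fun _ _ => sq_nonneg _)

theorem momentPoint_smul {l : ℝ} (hl : l ≠ 0) (r : Fin 3 → ℝ) :
    momentPoint (l • r) = momentPoint r := by
  funext i
  simp only [momentPoint, Pi.smul_apply, smul_eq_mul, mul_pow, ← Finset.mul_sum]
  exact mul_div_mul_left _ _ (pow_ne_zero 2 hl)

theorem momentPoint_sqrt {y : Fin 3 → ℝ} (h0 : ∀ i, 0 ≤ y i) (h1 : ∑ i, y i = 1) :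
    (momentPoint fun i => √(y i)) = y := by
  funext i
  simp only [momentPoint, Real.sq_sqrt (h0 _), h1, div_one]

theorem eq_smul_of_momentPoint_eq {r r' : Fin 3 → ℝ} (h0 : ∀ i, 0 ≤ r i) (h0' : ∀ i, 0 ≤ r' i)
    (hr : r ≠ 0) (hr' : r' ≠ 0) (h : momentPoint r = momentPoint r') :
    ∃ l : ℝ, 0 < l ∧ r' = l • r := by
  have hp := sum_sq_pos hr
  have hp' := sum_sq_pos hr'
  refine ⟨√(∑ j, r' j ^ 2) / √(∑ j, r j ^ 2), by positivity, ?_⟩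
  funext i
  have h2 : r i ^ 2 / ∑ j, r j ^ 2 = r' i ^ 2 / ∑ j, r' j ^ 2 := congrFun h i
  rw [Pi.smul_apply, smul_eq_mul]
  rw [← sq_eq_sq₀ (h0' i) (mul_nonneg (by positivity) (h0 i)), mul_pow, div_pow,
    Real.sq_sqrt hp.le, Real.sq_sqrt hp'.le]
  field_simp at h2 ⊢
  linarith

theorem eval_smul_of_isHomogeneous {p : MvPolynomial (Fin 3) ℂ} {d : ℕ} (hp : p.IsHomogeneous d)
    (l : ℂ) (z : Fin 3 → ℂ) :
    MvPolynomial.eval (l • z) p = l ^ d * MvPolynomial.eval z p := by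
  rw [MvPolynomial.eval_eq', MvPolynomial.eval_eq', Finset.mul_sum]
  refine Finset.sum_congr rfl fun J hJ => ?_
  have hd : ∑ i, J i = d := by
    rw [← Finsupp.degree_eq_sum]
    exact degree_of_mem_support hp hJ
  simp only [Pi.smul_apply, smul_eq_mul, mul_pow, Finset.prod_mul_distrib, Finset.prod_pow_eq_pow_sum,
    hd]
  ring

theorem mem_amoeba_iff {p : MvPolynomial (Fin 3) ℂ} {x : Fin 3 → ℝ} :
    x ∈ amoeba p ↔ ∃ z : Fin 3 → ℂ, z ≠ 0 ∧ MvPolynomial.eval z p = 0 ∧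
      x = momentPoint fun i => ‖z i‖ := by
  constructor
  · rintro ⟨y, ⟨z, hz, rfl, h⟩, rfl⟩
    exact ⟨z, hz, h, rfl⟩
  · rintro ⟨z, hz, h, rfl⟩
    exact ⟨_, ⟨z, hz, rfl, h⟩, rfl⟩

theorem norm_comp_ne_zero {z : Fin 3 → ℂ} (hz : z ≠ 0) : (fun i => ‖z i‖) ≠ 0 := by
  contrapose! hz
  funext i
  simpa using congrFun hz i

/-- The radii over a point of `Δ` are determined up to a positive factor, and homogeneity makes
vanishing insensitive to that factor. -/
theorem momentPoint_notMem_amoeba {p : MvPolynomial (Fin 3) ℂ} {d : ℕ} (hp : p.IsHomogeneous d)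
    {r : Fin 3 → ℝ} (h0 : ∀ i, 0 ≤ r i) (hr : r ≠ 0) :
    momentPoint r ∉ amoeba p ↔ NonvanishingOnTorus p r := by
  rw [mem_amoeba_iff, ← not_iff_not, not_not]
  constructor
  · rintro ⟨z, hz, hpz, hm⟩ h
    obtain ⟨l, hl, h2⟩ := eq_smul_of_momentPoint_eq (fun i => norm_nonneg (z i)) h0
      (norm_comp_ne_zero hz) hr hm.symm
    refine h ((l : ℂ) • z) (fun i => ?_) ?_
    · rw [h2]
      simp [abs_of_pos hl]
    · rw [eval_smul_of_isHomogeneous hp, hpz, mul_zero]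
  · intro h
    simp only [NonvanishingOnTorus, not_forall, not_not] at h
    obtain ⟨z, hz, hpz⟩ := h
    refine ⟨z, ?_, hpz, by simp only [hz]⟩
    rintro rfl
    exact hr (funext fun i => by simpa using (hz i).symm)

theorem amoeba_subset {p : MvPolynomial (Fin 3) ℂ} : amoeba p ⊆ stdSimplex ℝ (Fin 3) := by
  intro x hx
  obtain ⟨z, hz, -, rfl⟩ := mem_amoeba_iff.mp hx
  exact ⟨fun i => momentPoint_nonneg _ i, sum_momentPoint (norm_comp_ne_zero hz)⟩

/-! ### Dominating terms and the order -/

/-- The term of `p` with exponent `I` is larger on the torus of radii `r` than the sum of the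
absolute values of the other terms. -/
def Dominates (p : MvPolynomial (Fin 3) ℂ) (I : Fin 3 →₀ ℕ) (r : Fin 3 → ℝ) : Prop :=
  ∑ J ∈ p.support.erase I, ‖p.coeff J‖ * ∏ i, r i ^ J i < ‖p.coeff I‖ * ∏ i, r i ^ I i

theorem Dominates.norm_eval_sub_lt {p : MvPolynomial (Fin 3) ℂ} {I : Fin 3 →₀ ℕ}
    {z : Fin 3 → ℂ} (h : Dominates p I fun i => ‖z i‖) :
    ‖MvPolynomial.eval z p - p.coeff I * ∏ i, z i ^ I i‖ < ‖p.coeff I * ∏ i, z i ^ I i‖ := by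
  have hn : ∀ J, ‖p.coeff J * ∏ i, z i ^ J i‖ = ‖p.coeff J‖ * ∏ i, ‖z i‖ ^ J i := by
    intro J
    simp [norm_prod, norm_pow]
  have hI : I ∈ p.support := by
    rw [MvPolynomial.mem_support_iff]
    intro h0
    have h2 : ∑ J ∈ p.support.erase I, ‖p.coeff J‖ * ∏ i, ‖z i‖ ^ J i < 0 := by
      simpa [Dominates, h0] using h
    exact absurd h2 (not_lt.mpr (Finset.sum_nonneg fun J _ => by positivity))
  rw [MvPolynomial.eval_eq', ← Finset.add_sum_erase _ _ hI, add_sub_cancel_left, hn I]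
  refine (norm_sum_le _ _).trans_lt ?_
  simp only [hn]
  exact h

theorem Dominates.nonvanishingOnTorus {p : MvPolynomial (Fin 3) ℂ} {I : Fin 3 →₀ ℕ}
    {r : Fin 3 → ℝ} (h : Dominates p I r) : NonvanishingOnTorus p r := by
  intro z hz h0
  have h1 : Dominates p I fun i => ‖z i‖ := by simpa only [hz] using h
  have h2 := h1.norm_eval_sub_lt
  rw [h0, zero_sub, norm_neg] at h2
  exact lt_irrefl _ h2

theorem Dominates.smul {p : MvPolynomial (Fin 3) ℂ} {d : ℕ} (hp : p.IsHomogeneous d)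
    {I : Fin 3 →₀ ℕ} (hI : I.degree = d) {r : Fin 3 → ℝ} (h : Dominates p I r) {l : ℝ}
    (hl : 0 < l) : Dominates p I (l • r) := by
  have key : ∀ J : Fin 3 →₀ ℕ, J.degree = d →
      ‖p.coeff J‖ * ∏ i, (l • r) i ^ J i = l ^ d * (‖p.coeff J‖ * ∏ i, r i ^ J i) := by
    intro J hJ
    rw [Finsupp.degree_eq_sum] at hJ
    simp only [Pi.smul_apply, smul_eq_mul, mul_pow, Finset.prod_mul_distrib,
      Finset.prod_pow_eq_pow_sum, hJ]
    ring
  unfold Dominates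
  rw [key I hI, Finset.sum_congr rfl fun J hJ =>
    key J (degree_of_mem_support hp (Finset.mem_of_mem_erase hJ)), ← Finset.mul_sum]
  exact mul_lt_mul_of_pos_left h (by positivity)

/-- On the circle of radius `ρ` Rouché allows `p` to be replaced by its dominating term, which
restricts to a monomial of degree `∑ k_j I_j` in `w`. -/
theorem Dominates.rootCount_curvePoly {p : MvPolynomial (Fin 3) ℂ} {I : Fin 3 →₀ ℕ}
    {c : Fin 3 → ℂ} {k : Fin 3 → ℕ} {ρ : ℝ} (hρ : 0 < ρ)
    (h : Dominates p I fun j => ‖c j‖ * ρ ^ k j) :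
    rootCount (curvePoly p c k) ρ = ∑ j, k j * I j := by
  have h1 : ∀ w : ℂ, ‖w‖ = ρ → Dominates p I fun j => ‖c j * w ^ k j‖ := by
    intro w hw
    simpa [hw] using h
  have hm : ∀ w : ℂ, p.coeff I * ∏ j, (c j * w ^ k j) ^ I j =
      (p.coeff I * ∏ j, c j ^ I j) * w ^ (∑ j, k j * I j) := by
    intro w
    simp only [mul_pow, Finset.prod_mul_distrib, ← pow_mul, Finset.prod_pow_eq_pow_sum]
    ring
  have ha : p.coeff I * ∏ j, c j ^ I j ≠ 0 := by
    intro h0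
    have h2 := (h1 (ρ : ℂ) (by simp [abs_of_pos hρ])).norm_eval_sub_lt
    rw [hm, h0] at h2
    simp at h2
    exact absurd h2 (not_lt.mpr (norm_nonneg _))
  rw [← rootCount_monomial ha (∑ j, k j * I j) hρ]
  refine rootCount_eq_of_norm_sub_lt _ _ hρ fun w hw => ?_
  have h2 := (h1 w hw).norm_eval_sub_lt
  rw [hm] at h2
  rw [eval_curvePoly, Polynomial.eval_mul, Polynomial.eval_C, Polynomial.eval_pow,
    Polynomial.eval_X]
  exact h2

theorem Dominates.order_single {p : MvPolynomial (Fin 3) ℂ} {I : Fin 3 →₀ ℕ}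
    {c : Fin 3 → ℂ} (h : Dominates p I fun j => ‖c j‖) (j : Fin 3) :
    order p c (Pi.single j 1) = I j := by
  rw [order, Dominates.rootCount_curvePoly (I := I) one_pos (by simpa using h),
    Finset.sum_eq_single j]
  · simp
  · intro b _ hb
    simp [hb]
  · simp

/-- Along the diagonal loop, homogeneity turns `p` into `p(c) w ^ d`. -/
theorem sum_order_single {p : MvPolynomial (Fin 3) ℂ} {d : ℕ} (hp : p.IsHomogeneous d)
    {c : Fin 3 → ℂ} (h : NonvanishingOnTorus p fun i => ‖c i‖) :
    ∑ j, order p c (Pi.single j 1) = d := by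
  have h1 := order_eq_sum h 1
  simp only [Pi.one_apply, one_mul] at h1
  rw [← h1, order]
  have h2 : curvePoly p c 1 = Polynomial.C (MvPolynomial.eval c p) * Polynomial.X ^ d := by
    refine Polynomial.funext fun w => ?_
    have h3 : (fun j => c j * w ^ (1 : Fin 3 → ℕ) j) = w • c := by
      funext j
      simp [mul_comm]
    rw [eval_curvePoly, h3, eval_smul_of_isHomogeneous hp, Polynomial.eval_mul, Polynomial.eval_C,
      Polynomial.eval_pow, Polynomial.eval_X, mul_comm]
  rw [h2, rootCount_monomial (h c fun i => rfl) d one_pos]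

/-- The loop is constant when `c j = 0`. This keeps tori whose orders are all positive away from the
boundary of `Δ`. -/
theorem order_single_of_eq_zero (p : MvPolynomial (Fin 3) ℂ) {c : Fin 3 → ℂ} {j : Fin 3}
    (hj : c j = 0) : order p c (Pi.single j 1) = 0 := by
  have h2 : curvePoly p c (Pi.single j 1) = Polynomial.C (MvPolynomial.eval c p) := by
    refine Polynomial.funext fun w => ?_
    have h3 : (fun i => c i * w ^ (Pi.single j 1 : Fin 3 → ℕ) i) = c := by
      funext i
      by_cases hi : i = j
      · subst hi
        simp [hj]
      · simp [hi]
    rw [eval_curvePoly, h3, Polynomial.eval_C]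
  simp [order, rootCount, h2]

theorem rootCount_filter_eq {f : Polynomial ℂ} {a b : ℝ} (hab : a ≤ b)
    (h : rootCount f b ≤ rootCount f a) {w : ℂ} (hw : w ∈ f.roots) (hwb : ‖w‖ < b) : ‖w‖ < a := by
  have hle : f.roots.filter (fun r => ‖r‖ < a) ≤ f.roots.filter (fun r => ‖r‖ < b) :=
    Multiset.monotone_filter_right _ fun r hr => lt_of_lt_of_le hr hab
  have heq := Multiset.eq_of_le_of_card_le hle h
  have hm : w ∈ f.roots.filter (fun r => ‖r‖ < b) := Multiset.mem_filter.mpr ⟨hw, hwb⟩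
  rw [← heq] at hm
  exact (Multiset.mem_filter.mp hm).2

theorem order_congr_norm {p : MvPolynomial (Fin 3) ℂ} {c c' : Fin 3 → ℂ}
    (h : NonvanishingOnTorus p fun i => ‖c i‖) (hc : ∀ i, ‖c' i‖ = ‖c i‖) (k : Fin 3 → ℕ) :
    order p c' k = order p c k := by
  rw [← order_mul_circle h k fun j => Circle.exp ((c' j).arg - (c j).arg)]
  congr 1
  funext j
  conv_lhs => rw [← Complex.norm_mul_exp_arg_mul_I (c' j), hc]
  conv_rhs => rw [← Complex.norm_mul_exp_arg_mul_I (c j)]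
  rw [Circle.coe_exp, mul_assoc, ← Complex.exp_add]
  congr 2
  simp
  ring

/-- A torus on which `p` has order `I` is joined to a torus on which the `I`-th term dominates by
tori on which `p` does not vanish. -/
theorem nonvanishingOnTorus_of_order {p : MvPolynomial (Fin 3) ℂ} {I : Fin 3 →₀ ℕ}
    {c : Fin 3 → ℂ} (h : NonvanishingOnTorus p fun i => ‖c i‖)
    (hord : ∀ j, order p c (Pi.single j 1) = I j) {k : Fin 3 → ℕ} {ρ : ℝ}
    (hdom : Dominates p I fun j => ‖c j‖ * ρ ^ k j) {s : ℝ} (hs : 1 ≤ s) (hsρ : s ≤ ρ) :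
    NonvanishingOnTorus p fun j => ‖c j‖ * s ^ k j := by
  intro z hz h0
  have hs0 : 0 < s := by linarith
  have hρ : 0 < ρ := by linarith
  -- A zero `z` on the intermediate torus is moved back to the torus of `c`, so that it becomes the
  -- root `w = s` of a curve polynomial.
  set c' : Fin 3 → ℂ := fun j => z j / (s : ℂ) ^ k j with hc'
  have hcc : ∀ i, ‖c' i‖ = ‖c i‖ := by
    intro i
    simp only [hc', norm_div, norm_pow, hz, Complex.norm_real, Real.norm_of_nonneg hs0.le]
    field_simp
  have h' : NonvanishingOnTorus p fun i => ‖c' i‖ := by simpa only [hcc] using h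
  have hsz : (fun j => c' j * (s : ℂ) ^ k j) = z := by
    funext j
    simp only [hc']
    rw [div_mul_cancel₀]
    exact pow_ne_zero _ (by exact_mod_cast hs0.ne')
  have hroot : (curvePoly p c' k).eval (s : ℂ) = 0 := by rw [eval_curvePoly, hsz, h0]
  have hne : curvePoly p c' k ≠ 0 := by
    intro h1
    exact h'.eval_curvePoly_ne_zero (fun i => rfl) k (w := 1) (by simp) (by rw [h1]; simp)
  have hmem : (s : ℂ) ∈ (curvePoly p c' k).roots := (Polynomial.mem_roots hne).mpr hroot
  have hnorm : ‖(s : ℂ)‖ = s := by simp [abs_of_pos hs0]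
  have hdom' : Dominates p I fun j => ‖c' j‖ * ρ ^ k j := by simpa only [hcc] using hdom
  rcases hsρ.lt_or_eq with hlt | rfl
  · have h1 : rootCount (curvePoly p c' k) 1 = ∑ j, k j * I j := by
      have h2 := order_congr_norm h hcc k
      rw [order_eq_sum h] at h2
      simp only [hord] at h2
      exact h2
    have h3 := rootCount_filter_eq (hs.trans hsρ) (h1 ▸ (hdom'.rootCount_curvePoly hρ).le) hmem
      (by rwa [hnorm])
    rw [hnorm] at h3
    linarith
  · exact hdom.nonvanishingOnTorus z hz h0

/-! ### Dominance regions in logarithmic coordinates -/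

/-- The logarithms of the radii of the tori on which the `I`-th term dominates. -/
def dominanceRegion (p : MvPolynomial (Fin 3) ℂ) (I : Fin 3 →₀ ℕ) : Set (Fin 3 → ℝ) :=
  {u | Dominates p I fun i => Real.exp (u i)}

/-- Division by the `I`-th monomial leaves a sum of exponentials of linear forms against a constant,
which makes convexity visible. -/
theorem mem_dominanceRegion_iff {p : MvPolynomial (Fin 3) ℂ} {I : Fin 3 →₀ ℕ} {u : Fin 3 → ℝ} :
    u ∈ dominanceRegion p I ↔
      ∑ J ∈ p.support.erase I, ‖p.coeff J‖ * Real.exp (∑ i, ((J i : ℝ) - I i) * u i) <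
        ‖p.coeff I‖ := by
  have hprod : ∀ J : Fin 3 →₀ ℕ, ∏ i, Real.exp (u i) ^ J i = Real.exp (∑ i, (J i : ℝ) * u i) := by
    intro J
    rw [Real.exp_sum]
    exact Finset.prod_congr rfl fun i _ => by rw [← Real.exp_nat_mul]
  have hJ : ∀ J : Fin 3 →₀ ℕ, ‖p.coeff J‖ * ∏ i, Real.exp (u i) ^ J i =
      ‖p.coeff J‖ * Real.exp (∑ i, ((J i : ℝ) - I i) * u i) *
        Real.exp (∑ i, (I i : ℝ) * u i) := by
    intro J
    rw [hprod, mul_assoc, ← Real.exp_add, ← Finset.sum_add_distrib]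
    congr 3
    funext i
    ring
  show Dominates _ _ _ ↔ _
  unfold Dominates
  rw [hprod I, Finset.sum_congr rfl fun J _ => hJ J, ← Finset.sum_mul,
    mul_lt_mul_iff_left₀ (Real.exp_pos _)]

theorem isOpen_dominanceRegion (p : MvPolynomial (Fin 3) ℂ) (I : Fin 3 →₀ ℕ) :
    IsOpen (dominanceRegion p I) := by
  unfold dominanceRegion Dominates
  exact isOpen_lt (by fun_prop) (by fun_prop)

theorem convexOn_finset_sum {ι E : Type*} [AddCommGroup E] [Module ℝ E] (s : Finset ι)
    {f : ι → E → ℝ} (h : ∀ i ∈ s, ConvexOn ℝ Set.univ (f i)) :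
    ConvexOn ℝ Set.univ fun x => ∑ i ∈ s, f i x := by
  classical
  induction s using Finset.induction_on with
  | empty => simpa using convexOn_const (0 : ℝ) convex_univ
  | insert a s ha ih =>
    simp only [Finset.sum_insert ha]
    exact (h a (Finset.mem_insert_self a s)).add
      (ih fun i hi => h i (Finset.mem_insert_of_mem hi))

theorem convex_dominanceRegion (p : MvPolynomial (Fin 3) ℂ) (I : Fin 3 →₀ ℕ) :
    Convex ℝ (dominanceRegion p I) := by
  have h1 : ConvexOn ℝ Set.univ fun u : Fin 3 → ℝ => ∑ J ∈ p.support.erase I,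
      ‖p.coeff J‖ * Real.exp (∑ i, ((J i : ℝ) - I i) * u i) := by
    refine convexOn_finset_sum _ fun J _ => ?_
    let l : (Fin 3 → ℝ) →ₗ[ℝ] ℝ := ∑ i, ((J i : ℝ) - I i) • LinearMap.proj i
    have h2 := (convexOn_exp.comp_linearMap l).smul (norm_nonneg (p.coeff J))
    simpa [l, Function.comp_def] using h2
  have h2 := h1.convex_lt ‖p.coeff I‖
  have h3 : dominanceRegion p I = {u | u ∈ Set.univ ∧ ∑ J ∈ p.support.erase I,
      ‖p.coeff J‖ * Real.exp (∑ i, ((J i : ℝ) - I i) * u i) < ‖p.coeff I‖} := by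
    ext u
    rw [mem_dominanceRegion_iff]
    simp
  rw [h3]
  exact h2

theorem add_const_mem_dominanceRegion {p : MvPolynomial (Fin 3) ℂ} {d : ℕ}
    (hp : p.IsHomogeneous d) {I : Fin 3 →₀ ℕ} (hI : I.degree = d) {u : Fin 3 → ℝ}
    (hu : u ∈ dominanceRegion p I) (m : ℝ) : (fun i => u i + m) ∈ dominanceRegion p I := by
  have h : Dominates p I _ := Dominates.smul hp hI hu (Real.exp_pos m)
  show Dominates p I _
  convert h using 1
  funext i
  simp [Real.exp_add, mul_comm]

/-- Adding a constant to all coordinates of `v` preserves dominance and makes `v - u` nonnegative.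
Its direction is then approximated by natural vectors, and openness of the region absorbs the error.
-/
theorem exists_nat_direction {p : MvPolynomial (Fin 3) ℂ} {d : ℕ} (hp : p.IsHomogeneous d)
    {I : Fin 3 →₀ ℕ} (hI : I.degree = d) (hne : (dominanceRegion p I).Nonempty)
    (u : Fin 3 → ℝ) :
    ∃ k : Fin 3 → ℕ, ∃ t : ℝ, 0 < t ∧ (fun i => u i + k i * t) ∈ dominanceRegion p I := by
  obtain ⟨v, hv⟩ := hne
  set m : ℝ := ∑ i, |v i - u i|
  have hm : ∀ i, 0 ≤ v i + m - u i := by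
    intro i
    have h1 : |v i - u i| ≤ m :=
      Finset.single_le_sum (f := fun i => |v i - u i|) (fun j _ => abs_nonneg _) (Finset.mem_univ i)
    have h2 := neg_abs_le (v i - u i)
    linarith
  have hv' := add_const_mem_dominanceRegion hp hI hv m
  have ht : Filter.Tendsto (fun x : ℝ => fun i => u i + ⌊(v i + m - u i) * x⌋₊ * x⁻¹)
      Filter.atTop (nhds fun i => v i + m) := by
    refine tendsto_pi_nhds.mpr fun i => ?_
    have h1 := (tendsto_nat_floor_mul_div_atTop (R := ℝ) (hm i)).const_add (u i)
    simpa [div_eq_mul_inv] using h1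
  obtain ⟨x, hx, hx0⟩ := ((ht.eventually ((isOpen_dominanceRegion p I).mem_nhds hv')).and
    (Filter.eventually_gt_atTop 0)).exists
  exact ⟨fun i => ⌊(v i + m - u i) * x⌋₊, x⁻¹, by positivity, hx⟩

theorem ContinuousOn.momentPoint {X : Type*} [TopologicalSpace X] {f : X → Fin 3 → ℝ} {s : Set X}
    (hf : ContinuousOn f s) (h : ∀ x ∈ s, f x ≠ 0) :
    ContinuousOn (fun x => momentPoint (f x)) s := by
  have hi : ∀ i, ContinuousOn (fun x => f x i) s := continuousOn_pi.mp hf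
  refine continuousOn_pi.mpr fun i => ContinuousOn.div ((hi i).pow 2) ?_ fun x hx =>
    (sum_sq_pos (h x hx)).ne'
  exact continuousOn_finsetSum _ fun j _ => (hi j).pow 2

/-! ### Components of the complement and their orders -/

/-- The complement of the amoeba in the plane of the moment simplex. -/
def amoebaCompl (p : MvPolynomial (Fin 3) ℂ) : Set (Fin 3 → ℝ) := simplexPlane \ amoeba p

theorem momentPoint_mem_amoebaCompl {p : MvPolynomial (Fin 3) ℂ} {d : ℕ} (hp : p.IsHomogeneous d)
    {r : Fin 3 → ℝ} (h0 : ∀ i, 0 ≤ r i) (hr : r ≠ 0) (h : NonvanishingOnTorus p r) :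
    momentPoint r ∈ amoebaCompl p :=
  ⟨sum_momentPoint hr, (momentPoint_notMem_amoeba hp h0 hr).mpr h⟩

theorem nonvanishingOnTorus_sqrt {p : MvPolynomial (Fin 3) ℂ} {d : ℕ} (hp : p.IsHomogeneous d)
    {y : Fin 3 → ℝ} (hy : y ∈ amoebaCompl p) (h0 : ∀ i, 0 ≤ y i) :
    NonvanishingOnTorus p fun i => √(y i) := by
  have h1 : ∑ i, y i = 1 := hy.1
  refine (momentPoint_notMem_amoeba hp (fun i => Real.sqrt_nonneg _) ?_).mp ?_
  · intro h
    have h2 : ∀ i, y i = 0 := fun i => (Real.sqrt_eq_zero (h0 i)).mp (congrFun h i)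
    simp [h2] at h1
  · rw [momentPoint_sqrt h0 h1]
    exact hy.2

/-- The real point of the torus over `y`. -/
noncomputable def sqrtPoint (y : Fin 3 → ℝ) : Fin 3 → ℂ := fun j => (√(y j) : ℝ)

theorem norm_sqrtPoint (y : Fin 3 → ℝ) (i : Fin 3) : ‖sqrtPoint y i‖ = √(y i) := by
  simp [sqrtPoint, abs_of_nonneg (Real.sqrt_nonneg _)]

theorem continuous_sqrtPoint : Continuous sqrtPoint := by
  unfold sqrtPoint
  fun_prop

/-- The orders of `p` along the coordinate loops of the torus over `y`. -/
noncomputable def orderAt (p : MvPolynomial (Fin 3) ℂ) (y : Fin 3 → ℝ) : Fin 3 → ℕ :=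
  fun j => order p (sqrtPoint y) (Pi.single j 1)

theorem continuousOn_orderAt {p : MvPolynomial (Fin 3) ℂ} {d : ℕ} (hp : p.IsHomogeneous d) :
    ContinuousOn (orderAt p) {y | y ∈ amoebaCompl p ∧ ∀ i, 0 ≤ y i} := by
  rw [continuousOn_iff_continuous_domRestrict]
  refine continuous_pi fun j => ?_
  refine continuous_order p _ (c := fun y : {y | y ∈ amoebaCompl p ∧ ∀ i, 0 ≤ y i} => sqrtPoint y)
    (continuous_sqrtPoint.comp continuous_subtype_val) fun y => ?_
  simp only [norm_sqrtPoint]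
  exact nonvanishingOnTorus_sqrt hp y.2.1 y.2.2

/-- If all `I j` are positive, then a component of the complement of the amoeba that meets the set
of order `I` is contained in it. -/
theorem connectedComponentIn_subset_orderAt {p : MvPolynomial (Fin 3) ℂ} {d : ℕ}
    (hp : p.IsHomogeneous d) {I : Fin 3 →₀ ℕ} (hI : ∀ i, 0 < I i) {y : Fin 3 → ℝ}
    (hy : y ∈ amoebaCompl p) (h0 : ∀ i, 0 ≤ y i) (hord : orderAt p y = I) :
    connectedComponentIn (amoebaCompl p) y ⊆ {x | (∀ i, 0 ≤ x i) ∧ orderAt p x = I} := by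
  let f : amoebaCompl p → Fin 3 → ℕ := fun x => orderAt p x
  let S : Set (amoebaCompl p) := {x | ∀ i, 0 ≤ x.1 i}
  let T : Set (amoebaCompl p) := {x | ∀ i, 0 < x.1 i}
  have hf : ContinuousOn f S := (continuousOn_orderAt hp).comp
    continuous_subtype_val.continuousOn fun x hx => ⟨x.2, hx⟩
  have hval : ∀ i, Continuous fun x : amoebaCompl p => x.1 i := fun i =>
    (continuous_apply i).comp continuous_subtype_val
  have hS : IsClosed S := by
    simp only [S, Set.ofPred_forall]
    exact isClosed_iInter fun i => isClosed_le continuous_const (hval i)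
  have hT : IsOpen T := by
    simp only [T, Set.ofPred_forall]
    exact isOpen_iInter_of_finite fun i => isOpen_lt continuous_const (hval i)
  have hTS : T ⊆ S := fun x hx i => (hx i).le
  -- A positive order forces a positive coordinate, so the closed condition `0 ≤ x i` and the open
  -- one `0 < x i` agree here and the set is clopen.
  have hST : S ∩ f ⁻¹' {⇑I} = T ∩ f ⁻¹' {⇑I} := by
    ext x
    constructor
    · rintro ⟨hx, hfx⟩
      refine ⟨fun i => (hx i).lt_of_ne fun h => ?_, hfx⟩
      have h1 : f x i = 0 := order_single_of_eq_zero p (by simp [sqrtPoint, ← h])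
      have h2 : f x = I := hfx
      rw [h2] at h1
      exact (hI i).ne' h1
    · exact fun hx => ⟨hTS hx.1, hx.2⟩
  have hclopen : IsClopen (S ∩ f ⁻¹' {⇑I}) := by
    refine ⟨hf.preimage_isClosed_of_isClosed hS isClosed_singleton, ?_⟩
    rw [hST]
    exact (hf.mono hTS).isOpen_inter_preimage hT (isOpen_discrete _)
  rw [connectedComponentIn_eq_image hy]
  rintro _ ⟨x, hx, rfl⟩
  have hmem : (⟨y, hy⟩ : amoebaCompl p) ∈ S ∩ f ⁻¹' {⇑I} := ⟨h0, hord⟩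
  exact hclopen.connectedComponent_subset hmem hx

/-- A component of the complement of the amoeba that contains a point outside the interior of the
moment simplex is unbounded. -/
theorem not_isBounded_of_nonpos {p : MvPolynomial (Fin 3) ℂ} {y : Fin 3 → ℝ}
    (hy : y ∈ amoebaCompl p) {i : Fin 3} (hi : y i ≤ 0) :
    ¬ Bornology.IsBounded (connectedComponentIn (amoebaCompl p) y) := by
  -- The ray from `y` away from the barycentre: its `i`-th coordinate is at most `-t / 3`, so it is
  -- outside `Δ` for `t > 0`.
  let γ : ℝ → Fin 3 → ℝ := fun t j => y j + t * (y j - 1 / 3)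
  have hγ : Continuous γ := by fun_prop
  have h1 : ∑ i, y i = 1 := hy.1
  have hray : γ '' Set.Ici 0 ⊆ connectedComponentIn (amoebaCompl p) y := by
    refine IsPreconnected.subset_connectedComponentIn
      (isPreconnected_Ici.image γ hγ.continuousOn) ⟨0, Set.self_mem_Ici, by simp [γ]⟩ ?_
    rintro _ ⟨t, ht, rfl⟩
    rcases (Set.mem_Ici.mp ht).eq_or_lt with rfl | ht
    · simpa [γ] using hy
    · refine ⟨?_, fun h => ?_⟩
      · show ∑ j, γ t j = 1
        simp only [Fin.sum_univ_three, γ] at h1 ⊢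
        linear_combination (1 + t) * h1
      · have h2 := (amoeba_subset h).1 i
        simp only [γ] at h2
        nlinarith
  intro hb
  have hb' := hb.subset hray
  rw [isBounded_iff_forall_norm_le] at hb'
  obtain ⟨C, hC⟩ := hb'
  -- At this parameter the `i`-th coordinate is at most `-(|C| + 1)`.
  have h2 := hC (γ (3 * |C| + 3)) ⟨_, by simp only [Set.mem_Ici]; positivity, rfl⟩
  have h3 := (norm_le_pi_norm (γ (3 * |C| + 3)) i).trans h2
  rw [Real.norm_eq_abs] at h3
  have h4 := (abs_le.mp h3).1
  have h5 := le_abs_self C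
  simp only [γ] at h4
  have h6 := abs_nonneg C
  nlinarith

theorem exp_comp_ne_zero (u : Fin 3 → ℝ) : (fun i => Real.exp (u i)) ≠ 0 := fun h =>
  (Real.exp_pos (u 0)).ne' (congrFun h 0)

/-- The image in the moment simplex of a point in logarithmic coordinates. -/
noncomputable def expPoint (u : Fin 3 → ℝ) : Fin 3 → ℝ := momentPoint fun i => Real.exp (u i)

theorem expPoint_mem_amoebaCompl {p : MvPolynomial (Fin 3) ℂ} {d : ℕ}
    (hp : p.IsHomogeneous d) {I : Fin 3 →₀ ℕ} {u : Fin 3 → ℝ} (hu : u ∈ dominanceRegion p I) :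
    expPoint u ∈ amoebaCompl p :=
  momentPoint_mem_amoebaCompl hp (fun _ => (Real.exp_pos _).le) (exp_comp_ne_zero u)
    (Dominates.nonvanishingOnTorus hu)

theorem orderAt_momentPoint {p : MvPolynomial (Fin 3) ℂ} {d : ℕ} (hp : p.IsHomogeneous d)
    {I : Fin 3 →₀ ℕ} (hI : I.degree = d) {r : Fin 3 → ℝ} (h0 : ∀ i, 0 ≤ r i) (hr : r ≠ 0)
    (h : Dominates p I r) : orderAt p (momentPoint r) = I := by
  funext j
  refine Dominates.order_single ?_ j
  have hpos := sum_sq_pos hr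
  have h1 := h.smul hp hI (l := (√(∑ j, r j ^ 2))⁻¹) (by positivity)
  convert h1 using 1
  funext i
  rw [norm_sqrtPoint, momentPoint, Real.sqrt_div' _ hpos.le, Real.sqrt_sq (h0 i), Pi.smul_apply,
    smul_eq_mul, div_eq_inv_mul]

theorem connectedComponentIn_expPoint_eq {p : MvPolynomial (Fin 3) ℂ} {d : ℕ}
    (hp : p.IsHomogeneous d) {I : Fin 3 →₀ ℕ} {u v : Fin 3 → ℝ}
    (hu : u ∈ dominanceRegion p I) (hv : v ∈ dominanceRegion p I) :
    connectedComponentIn (amoebaCompl p) (expPoint u) =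
      connectedComponentIn (amoebaCompl p) (expPoint v) := by
  have hc : ContinuousOn expPoint (dominanceRegion p I) :=
    ContinuousOn.momentPoint (by fun_prop) fun u _ => exp_comp_ne_zero u
  have hpre := (convex_dominanceRegion p I).isPreconnected.image _ hc
  refine connectedComponentIn_eq ?_
  refine hpre.subset_connectedComponentIn ⟨u, hu, rfl⟩ ?_ ⟨v, hv, rfl⟩
  rintro _ ⟨w, hw, rfl⟩
  exact expPoint_mem_amoebaCompl hp hw

/-- The points of the complement of the amoeba of order `I` are in the component of the points
where the `I`-th term dominates. -/
theorem connectedComponentIn_eq_of_orderAt {p : MvPolynomial (Fin 3) ℂ} {d : ℕ}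
    (hp : p.IsHomogeneous d) {I : Fin 3 →₀ ℕ} (hI : I.degree = d) {u : Fin 3 → ℝ}
    (hu : u ∈ dominanceRegion p I) {y : Fin 3 → ℝ} (hy : y ∈ amoebaCompl p)
    (h0 : ∀ i, 0 < y i) (hord : orderAt p y = I) :
    connectedComponentIn (amoebaCompl p) y =
      connectedComponentIn (amoebaCompl p) (expPoint u) := by
  obtain ⟨k, t, ht, hk⟩ := exists_nat_direction hp hI ⟨u, hu⟩ fun i => Real.log √(y i)
  rw [connectedComponentIn_expPoint_eq hp hu hk]
  have hs : ∀ i, 0 < √(y i) := fun i => Real.sqrt_pos.mpr (h0 i)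
  have hexp : (fun i => Real.exp (Real.log √(y i) + k i * t)) =
      fun i => √(y i) * Real.exp t ^ k i := by
    funext i
    rw [Real.exp_add, Real.exp_log (hs i), Real.exp_nat_mul]
  have hdom : Dominates p I fun i => √(y i) * Real.exp t ^ k i := by
    rw [← hexp]
    exact hk
  have h1 : 1 ≤ Real.exp t := Real.one_le_exp ht.le
  let γ : ℝ → Fin 3 → ℝ := fun s => momentPoint fun i => √(y i) * s ^ k i
  have hpos : ∀ s ∈ Set.Icc 1 (Real.exp t), ∀ i, 0 < √(y i) * s ^ k i := by
    intro s hs' i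
    have h2 : 0 < s := by linarith [hs'.1]
    have := hs i
    positivity
  have hne : ∀ s ∈ Set.Icc 1 (Real.exp t), (fun i => √(y i) * s ^ k i) ≠ 0 := fun s hs' h =>
    (hpos s hs' 0).ne' (congrFun h 0)
  have hγ : ContinuousOn γ (Set.Icc 1 (Real.exp t)) := ContinuousOn.momentPoint (by fun_prop) hne
  refine connectedComponentIn_eq ?_
  refine (isPreconnected_Icc.image γ hγ).subset_connectedComponentIn ⟨1, ⟨le_rfl, h1⟩, ?_⟩ ?_
    ⟨Real.exp t, ⟨h1, le_rfl⟩, ?_⟩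
  · simp only [γ, one_pow, mul_one]
    exact momentPoint_sqrt (fun i => (h0 i).le) hy.1
  · rintro _ ⟨s, hs', rfl⟩
    refine momentPoint_mem_amoebaCompl hp (fun i => (hpos s hs' i).le) (hne s hs') ?_
    have h2 := nonvanishingOnTorus_of_order (p := p) (I := I) (c := sqrtPoint y) (k := k)
      (ρ := Real.exp t) (s := s)
    simp only [norm_sqrtPoint] at h2
    exact h2 (nonvanishingOnTorus_sqrt hp hy fun i => (h0 i).le) (fun j => congrFun hord j) hdom
      hs'.1 hs'.2
  · simp only [γ, expPoint, hexp]

/-- Shrinking a radius that does not occur in the `I`-th term leaves that term unchanged and cannot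
increase the others. This carries dominance to the boundary of `Δ`. -/
theorem Dominates.mono_of_eq_zero {p : MvPolynomial (Fin 3) ℂ} {I : Fin 3 →₀ ℕ}
    {r r' : Fin 3 → ℝ} (h0 : ∀ j, 0 ≤ r' j) (hr : ∀ j, r' j = r j ∨ I j = 0 ∧ r' j ≤ r j)
    (h : Dominates p I r) : Dominates p I r' := by
  have h1 : ∏ j, r' j ^ I j = ∏ j, r j ^ I j := by
    refine Finset.prod_congr rfl fun j _ => ?_
    rcases hr j with hj | hj
    · rw [hj]
    · simp [hj.1]
  unfold Dominates
  rw [h1]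
  refine lt_of_le_of_lt (Finset.sum_le_sum fun J _ => ?_) h
  refine mul_le_mul_of_nonneg_left ?_ (norm_nonneg _)
  refine Finset.prod_le_prod (fun j _ => pow_nonneg (h0 j) _) fun j _ => ?_
  exact pow_le_pow_left₀ (h0 j) ((hr j).elim le_of_eq And.right) _

/-- Shrinking the `i`-th radius to `0` preserves dominance, so the component reaches the edge `x i =
0` and, by `not_isBounded_of_nonpos`, infinity. -/
theorem not_isBounded_of_eq_zero {p : MvPolynomial (Fin 3) ℂ} {d : ℕ}
    (hp : p.IsHomogeneous d) {I : Fin 3 →₀ ℕ} {i : Fin 3} (hi : I i = 0) {u : Fin 3 → ℝ}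
    (hu : u ∈ dominanceRegion p I) :
    ¬ Bornology.IsBounded (connectedComponentIn (amoebaCompl p) (expPoint u)) := by
  let r : ℝ → Fin 3 → ℝ := fun s => Function.update (fun j => Real.exp (u j)) i (s * Real.exp (u i))
  have hr : Continuous r := continuous_const.update i (by fun_prop)
  have hri : ∀ s, r s i = s * Real.exp (u i) := fun s => by simp [r]
  have hrj : ∀ s j, j ≠ i → r s j = Real.exp (u j) := fun s j hj => by simp [r, hj]
  have hne : ∀ s, r s ≠ 0 := by
    intro s h
    have h1 : i + 1 ≠ i := by fin_cases i <;> decide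
    have h2 := congrFun h (i + 1)
    rw [hrj s _ h1] at h2
    exact (Real.exp_pos _).ne' h2
  have h0 : ∀ s ∈ Set.Icc (0 : ℝ) 1, ∀ j, 0 ≤ r s j := by
    intro s hs j
    by_cases hj : j = i
    · subst hj
      rw [hri]
      exact mul_nonneg hs.1 (Real.exp_pos _).le
    · rw [hrj s j hj]
      exact (Real.exp_pos _).le
  let γ : ℝ → Fin 3 → ℝ := fun s => momentPoint (r s)
  have hγ : ContinuousOn γ (Set.Icc 0 1) := ContinuousOn.momentPoint hr.continuousOn fun s _ => hne s
  have hmem : ∀ s ∈ Set.Icc (0 : ℝ) 1, γ s ∈ amoebaCompl p := by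
    intro s hs
    refine momentPoint_mem_amoebaCompl hp (h0 s hs) (hne s) ?_
    refine (Dominates.mono_of_eq_zero (h0 s hs) (fun j => ?_) hu).nonvanishingOnTorus
    by_cases hj : j = i
    · subst hj
      rw [hri]
      exact Or.inr ⟨hi, mul_le_of_le_one_left (Real.exp_pos _).le hs.2⟩
    · exact Or.inl (hrj s j hj)
  have h1 : γ 1 = expPoint u := by simp [γ, r, expPoint]
  have h2 : γ 0 ∈ connectedComponentIn (amoebaCompl p) (expPoint u) := by
    refine (isPreconnected_Icc.image γ hγ).subset_connectedComponentIn
      ⟨1, by simp, h1⟩ ?_ ⟨0, by simp, rfl⟩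
    rintro _ ⟨s, hs, rfl⟩
    exact hmem s hs
  rw [connectedComponentIn_eq h2]
  refine not_isBounded_of_nonpos (hmem 0 (by simp)) (i := i) ?_
  simp [γ, momentPoint, hri]

/-! ### Counting the holes -/

/-- The lattice points in the interior of the Newton polygon. -/
def interiorExponents (d : ℕ) : Set (Fin 3 →₀ ℕ) := {I | I.degree = d ∧ ∀ i, 0 < I i}

theorem encard_interiorExponents (d : ℕ) :
    (interiorExponents d).encard = (((d - 1) * (d - 2) / 2 : ℕ) : ℕ∞) := by
  let S : Finset ((_ : ℕ) × ℕ) := (Finset.range (d - 2)).sigma fun a => Finset.range (d - 2 - a)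
  -- The first two entries are shifted by one; the third is positive because `x.1 + x.2 < d - 2` on
  -- `S`.
  let f : (_ : ℕ) × ℕ → (Fin 3 →₀ ℕ) := fun x =>
    Finsupp.equivFunOnFinite.symm ![x.1 + 1, x.2 + 1, d - 2 - x.1 - x.2]
  have hS : S.card = (d - 1) * (d - 2) / 2 := by
    rw [Finset.card_sigma]
    simp only [Finset.card_range]
    have h1 : ∑ a ∈ Finset.range (d - 2), (d - 2 - a) = ∑ a ∈ Finset.range (d - 2), (a + 1) := by
      rw [← Finset.sum_range_reflect]
      refine Finset.sum_congr rfl fun a ha => ?_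
      have := Finset.mem_range.mp ha
      omega
    have h2 : ∑ a ∈ Finset.range (d - 2), (a + 1) = ∑ a ∈ Finset.range (d - 2 + 1), a := by
      rw [Finset.sum_range_succ']
      simp
    rw [h1, h2, Finset.sum_range_id]
    rcases Nat.lt_or_ge d 2 with h | h
    · have : d - 2 = 0 := by omega
      simp [this]
    · have : d - 2 + 1 = d - 1 := by omega
      rw [this]
      congr 2
  have hinj : Set.InjOn f S := by
    rintro ⟨a, b⟩ - ⟨a', b'⟩ - h
    have h0 := DFunLike.congr_fun h 0
    have h1 := DFunLike.congr_fun h 1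
    simp [f] at h0 h1
    simp [h0, h1]
  have himg : interiorExponents d = f '' S := by
    ext I
    simp only [interiorExponents, Set.mem_ofPred_eq, Finsupp.degree_eq_sum, Fin.sum_univ_three]
    constructor
    · rintro ⟨hd, hI⟩
      have h0 := hI 0
      have h1 := hI 1
      have h2 := hI 2
      refine ⟨⟨I 0 - 1, I 1 - 1⟩, ?_, ?_⟩
      · simp only [S, Finset.coe_sigma, Set.mem_sigma_iff, Finset.mem_coe, Finset.mem_range]
        omega
      · ext i
        fin_cases i <;> simp [f] <;> omega
    · rintro ⟨⟨a, b⟩, hab, rfl⟩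
      simp only [S, Finset.coe_sigma, Set.mem_sigma_iff, Finset.mem_coe, Finset.mem_range] at hab
      refine ⟨?_, ?_⟩
      · simp [f]
        omega
      · intro i
        fin_cases i <;> simp [f]
        omega
  rw [himg, hinj.encard_image, Set.encard_coe_eq_coe_finsetCard, hS]

/-- If every term of `p` dominates somewhere, then the amoeba has as many holes as the Newton
polygon has interior lattice points. -/
theorem encard_holes {p : MvPolynomial (Fin 3) ℂ} {d : ℕ} (hp : p.IsHomogeneous d)
    (hdom : ∀ I : Fin 3 →₀ ℕ, I.degree = d → (dominanceRegion p I).Nonempty) :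
    (holes (amoeba p)).encard = (((d - 1) * (d - 2) / 2 : ℕ) : ℕ∞) := by
  choose! u hu using hdom
  have hsub : ∀ I ∈ interiorExponents d,
      connectedComponentIn (amoebaCompl p) (expPoint (u I)) ⊆
        {x | (∀ i, 0 ≤ x i) ∧ orderAt p x = I} := fun I hI =>
    connectedComponentIn_subset_orderAt hp hI.2 (expPoint_mem_amoebaCompl hp (hu I hI.1))
      (momentPoint_nonneg _)
      (orderAt_momentPoint hp hI.1 (fun _ => (Real.exp_pos _).le) (exp_comp_ne_zero _) (hu I hI.1))
  have hinj : Set.InjOn (fun I => connectedComponentIn (amoebaCompl p) (expPoint (u I)))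
      (interiorExponents d) := by
    intro I hI J hJ h
    have hmem := mem_connectedComponentIn (expPoint_mem_amoebaCompl hp (hu I hI.1))
    have h1 := (hsub I hI hmem).2
    have h2 : connectedComponentIn (amoebaCompl p) (expPoint (u I)) =
      connectedComponentIn (amoebaCompl p) (expPoint (u J)) := h
    rw [h2] at hmem
    have h3 := (hsub J hJ hmem).2
    exact DFunLike.coe_injective (h1.symm.trans h3)
  rw [← encard_interiorExponents, ← hinj.encard_image]
  congr 1
  ext U
  constructor
  · rintro ⟨⟨x, hx, rfl⟩, hb⟩
    change x ∈ amoebaCompl p at hx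
    change Bornology.IsBounded (connectedComponentIn (amoebaCompl p) x) at hb
    have hpos : ∀ i, 0 < x i := by
      intro i
      by_contra! hi
      exact not_isBounded_of_nonpos hx hi hb
    let I : Fin 3 →₀ ℕ := Finsupp.equivFunOnFinite.symm (orderAt p x)
    have hord : orderAt p x = I := by simp [I]
    have hI : I.degree = d := by
      rw [Finsupp.degree_eq_sum]
      simp only [← hord]
      refine sum_order_single hp ?_
      simp only [norm_sqrtPoint]
      exact nonvanishingOnTorus_sqrt hp hx fun i => (hpos i).le
    have heq := connectedComponentIn_eq_of_orderAt hp hI (hu I hI) hx hpos hord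
    refine ⟨I, ⟨hI, fun i => Nat.pos_of_ne_zero fun hi => ?_⟩, heq.symm⟩
    rw [heq] at hb
    exact not_isBounded_of_eq_zero hp hi (hu I hI) hb
  · rintro ⟨I, hI, rfl⟩
    refine ⟨⟨_, expPoint_mem_amoebaCompl hp (hu I hI.1), rfl⟩, ?_⟩
    refine (isCompact_stdSimplex ℝ (Fin 3)).isBounded.subset fun x hx => ⟨(hsub I hI hx).1, ?_⟩
    exact (connectedComponentIn_subset _ _ hx).1

/-! ### Counting the points on the edges -/

theorem natDegree_curvePoly_le {p : MvPolynomial (Fin 3) ℂ} {d : ℕ} (hp : p.IsHomogeneous d)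
    (c : Fin 3 → ℂ) (l : Fin 3) : (curvePoly p c (Pi.single l 1)).natDegree ≤ d := by
  rw [curvePoly, MvPolynomial.aeval_def, MvPolynomial.eval₂_eq']
  refine Polynomial.natDegree_sum_le_of_forall_le _ _ fun J hJ => ?_
  have hd := degree_of_mem_support hp hJ
  rw [Finsupp.degree_eq_sum] at hd
  rw [Polynomial.algebraMap_eq, ← hd]
  refine (Polynomial.natDegree_C_mul_le _ _).trans ?_
  refine (Polynomial.natDegree_prod_le _ _).trans (Finset.sum_le_sum fun i _ => ?_)
  refine Polynomial.natDegree_pow_le.trans ?_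
  refine (Nat.mul_le_mul_left _ (Polynomial.natDegree_C_mul_X_pow_le _ _)).trans ?_
  by_cases hi : i = l
  · subst hi
    simp
  · simp [hi]

theorem exists_root_of_rootCount_lt {f : Polynomial ℂ} {a b : ℝ}
    (h : rootCount f a < rootCount f b) : ∃ w ∈ f.roots, a ≤ ‖w‖ ∧ ‖w‖ < b := by
  by_contra! hcon
  refine absurd h (not_lt.mpr (Multiset.card_le_card ?_))
  rw [Multiset.le_filter]
  refine ⟨Multiset.filter_le _ _, fun w hw => ?_⟩
  obtain ⟨hw1, hw2⟩ := Multiset.mem_filter.mp hw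
  by_contra! h1
  exact absurd hw2 (not_lt.mpr (hcon w hw1 h1))

theorem rootCount_mono (f : Polynomial ℂ) {a b : ℝ} (h : a ≤ b) :
    rootCount f a ≤ rootCount f b :=
  Multiset.card_le_card (Multiset.monotone_filter_right _ fun _ hr => lt_of_lt_of_le hr h)

/-- If every term of `p` dominates somewhere, then the amoeba meets each edge in `d` points. -/
theorem encard_amoeba_inter_edge {p : MvPolynomial (Fin 3) ℂ} {d : ℕ} (hp : p.IsHomogeneous d)
    (hdom : ∀ I : Fin 3 →₀ ℕ, I.degree = d → (dominanceRegion p I).Nonempty) (i : Fin 3) :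
    (amoeba p ∩ edge i).encard = (d : ℕ∞) := by
  obtain ⟨j, l, hji, hli, hlj, hall⟩ : ∃ j l : Fin 3, j ≠ i ∧ l ≠ i ∧ l ≠ j ∧
      ∀ m, m = i ∨ m = j ∨ m = l := by
    revert i
    decide
  have hsum : ∀ a b : ℕ, ∑ m, (Function.update (Function.update (0 : Fin 3 → ℕ) j a) l b) m =
      a + b := by
    intro a b
    rw [Finset.sum_update_of_mem (Finset.mem_univ l), ← Finset.erase_eq,
      Finset.sum_eq_single j]
    · simp [add_comm]
    · intro m _ hm
      simp [hm]
    · intro h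
      exact absurd (Finset.mem_erase.mpr ⟨hlj.symm, Finset.mem_univ j⟩) h
  have hexp : ∀ m ≤ d, ∃ I : Fin 3 →₀ ℕ, I.degree = d ∧ I i = 0 ∧ I j = d - m ∧ I l = m := by
    intro m hm
    refine ⟨Finsupp.equivFunOnFinite.symm
      (Function.update (Function.update (0 : Fin 3 → ℕ) j (d - m)) l m), ?_, ?_, ?_, ?_⟩
    · rw [Finsupp.degree_eq_sum]
      simp only [Finsupp.equivFunOnFinite_symm_apply_apply, hsum]
      omega
    · simp [hji.symm, hli.symm]
    · simp [hlj.symm]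
    · simp
  -- The edge `z i = 0` in the chart `z j = 1`, with coordinate `w = z l`.
  let c : Fin 3 → ℂ := fun m => if m = i then 0 else 1
  let k : Fin 3 → ℕ := Pi.single l 1
  let r : ℝ → Fin 3 → ℝ := fun t m => ‖c m‖ * t ^ k m
  have hri : ∀ t, r t i = 0 := fun t => by simp [r, c]
  have hrj : ∀ t, r t j = 1 := fun t => by simp [r, c, k, hji, hlj.symm]
  have hrl : ∀ t, r t l = t := fun t => by simp [r, c, k, hli]
  have hrne : ∀ t, r t ≠ 0 := fun t h => by
    have := congrFun h j
    rw [hrj] at this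
    simp at this
  have hr0 : ∀ t, 0 ≤ t → ∀ m, 0 ≤ r t m := fun t ht m => by positivity
  let q := curvePoly p c k
  have hdomr : ∀ m ≤ d, ∃ (I : Fin 3 →₀ ℕ) (ρ : ℝ), I l = m ∧ 0 < ρ ∧ Dominates p I (r ρ) := by
    intro m hm
    obtain ⟨I, hId, hIi, hIj, hIl⟩ := hexp m hm
    obtain ⟨u, hu⟩ := hdom I hId
    refine ⟨I, Real.exp (u l - u j), hIl, Real.exp_pos _, ?_⟩
    -- A dominated torus is moved to the edge by setting its `i`-th radius to `0`; rescaling then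
    -- makes the `j`-th radius `1`.
    have h1 : Dominates p I (Real.exp (u j) • r (Real.exp (u l - u j))) := by
      refine Dominates.mono_of_eq_zero (fun m => ?_) (fun m => ?_) hu
      · exact mul_nonneg (Real.exp_pos _).le (hr0 _ (Real.exp_pos _).le m)
      · rcases hall m with rfl | rfl | rfl
        · right
          refine ⟨hIi, ?_⟩
          simp [hri, (Real.exp_pos _).le]
        · left
          simp [hrj]
        · left
          simp [hrl, ← Real.exp_add]
    have h2 := h1.smul hp hId (Real.exp_pos (-u j))
    rwa [smul_smul, ← Real.exp_add, neg_add_cancel, Real.exp_zero, one_smul] at h2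
  have hcount : ∀ m ≤ d, ∃ ρ : ℝ, rootCount q ρ = m := by
    intro m hm
    obtain ⟨I, ρ, hIl, hρ, hIρ⟩ := hdomr m hm
    refine ⟨ρ, ?_⟩
    rw [Dominates.rootCount_curvePoly (c := c) (k := k) hρ hIρ, Finset.sum_eq_single l]
    · simp [k, hIl]
    · intro b _ hb
      simp [k, hb]
    · simp
  choose! ρ hρ using hcount
  have hq : q ≠ 0 := by
    obtain ⟨I, ρ, -, hρ, hIρ⟩ := hdomr d le_rfl
    intro h0
    refine hIρ.nonvanishingOnTorus (fun m => c m * (ρ : ℂ) ^ k m) (fun m => ?_) ?_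
    · simp [r, abs_of_pos hρ]
    · rw [← eval_curvePoly]
      change q.eval _ = 0
      rw [h0, Polynomial.eval_zero]
  have hinjr : ∀ s t : ℝ, 0 ≤ s → 0 ≤ t → momentPoint (r s) = momentPoint (r t) → s = t := by
    intro s t hs ht h
    obtain ⟨a, -, h1⟩ := eq_smul_of_momentPoint_eq (hr0 s hs) (hr0 t ht) (hrne s) (hrne t) h
    have h2 := congrFun h1 j
    have h3 := congrFun h1 l
    simp only [Pi.smul_apply, smul_eq_mul, hrj, hrl] at h2 h3
    rw [h3, ← mul_one a, ← h2, one_mul]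
  apply le_antisymm
  · have hsub : amoeba p ∩ edge i ⊆ (fun w : ℂ => momentPoint (r ‖w‖)) '' q.roots.toFinset := by
      rintro x ⟨hx, -, hxi⟩
      obtain ⟨z, hz, hpz, rfl⟩ := mem_amoeba_iff.mp hx
      have hzi : z i = 0 := by
        rw [momentPoint, div_eq_zero_iff] at hxi
        rcases hxi with h | h
        · simpa using h
        · exact absurd h (sum_sq_pos (norm_comp_ne_zero hz)).ne'
      -- The vertex `z i = z j = 0`, missed by the chart, is off the curve because the term `z l ^
      -- d` dominates there.
      have hzj : z j ≠ 0 := by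
        intro hzj
        have hzl : z l ≠ 0 := by
          intro hzl
          refine hz (funext fun m => ?_)
          rcases hall m with rfl | rfl | rfl <;> assumption
        obtain ⟨I, hId, hIi, hIj, hIl⟩ := hexp d le_rfl
        obtain ⟨u, hu⟩ := hdom I hId
        have hzl' : 0 < ‖z l‖ := norm_pos_iff.mpr hzl
        have h1 : Dominates p I ((Real.exp (u l) / ‖z l‖) • fun m => ‖z m‖) := by
          refine Dominates.mono_of_eq_zero (fun m => ?_) (fun m => ?_) hu
          · simp only [Pi.smul_apply, smul_eq_mul]
            positivity
          · rcases hall m with rfl | rfl | rfl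
            · right
              simp [hIi, hzi, (Real.exp_pos _).le]
            · right
              simp [hIj, hzj, (Real.exp_pos _).le]
            · left
              simp only [Pi.smul_apply, smul_eq_mul]
              field_simp
        have h2 := h1.smul hp hId (l := ‖z l‖ / Real.exp (u l)) (by positivity)
        rw [smul_smul, div_mul_div_cancel₀ (Real.exp_pos _).ne', div_self hzl'.ne', one_smul] at h2
        exact h2.nonvanishingOnTorus z (fun m => rfl) hpz
      have hzw : z = z j • fun m => c m * (z l / z j) ^ k m := by
        funext m
        rcases hall m with rfl | rfl | rfl
        · simp [c, hzi]
        · simp [c, k, hji, hlj.symm]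
        · simp [c, k, hli]
          field_simp
      refine ⟨z l / z j, ?_, ?_⟩
      · simp only [Finset.mem_coe, Multiset.mem_toFinset]
        rw [Polynomial.mem_roots hq, Polynomial.IsRoot.def, eval_curvePoly]
        rw [hzw, eval_smul_of_isHomogeneous hp] at hpz
        exact (mul_eq_zero.mp hpz).resolve_left (pow_ne_zero _ hzj)
      · have h1 : (fun m => ‖z m‖) = ‖z j‖ • r ‖z l / z j‖ := by
          funext m
          conv_lhs => rw [hzw]
          simp [r]
        simp only [h1]
        rw [momentPoint_smul (norm_ne_zero_iff.mpr hzj)]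
    refine (Set.encard_le_encard hsub).trans ((Set.encard_image_le _ _).trans ?_)
    rw [Set.encard_coe_eq_coe_finsetCard]
    exact_mod_cast (Multiset.toFinset_card_le _).trans
      ((Polynomial.card_roots' q).trans (natDegree_curvePoly_le hp c l))
  -- The count rises from `m` to `m + 1` between the radii `ρ m` and `ρ (m + 1)`, so each of these
  -- `d` annuli contains a root.
  · have hw : ∀ m : Fin d, ∃ w ∈ q.roots, ρ m ≤ ‖w‖ ∧ ‖w‖ < ρ (m + 1) := by
      intro m
      refine exists_root_of_rootCount_lt ?_
      have := m.2
      rw [hρ m (by omega), hρ (m + 1) (by omega)]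
      omega
    choose w hwq hw1 hw2 using hw
    have hmono : StrictMono fun m : Fin d => ‖w m‖ := by
      intro m n hmn
      refine lt_of_lt_of_le (hw2 m) (le_trans ?_ (hw1 n))
      have hmn' : (m : ℕ) < n := hmn
      have := n.2
      by_contra! hlt
      have h1 := rootCount_mono q hlt.le
      rw [hρ n (by omega), hρ (m + 1) (by omega)] at h1
      have h2 : (n : ℕ) = m + 1 := by omega
      rw [h2] at hlt
      exact lt_irrefl _ hlt
    have hinj : Function.Injective fun m : Fin d => momentPoint (r ‖w m‖) := fun m n h =>
      hmono.injective (hinjr _ _ (norm_nonneg _) (norm_nonneg _) h)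
    have hrange : Set.range (fun m : Fin d => momentPoint (r ‖w m‖)) ⊆ amoeba p ∩ edge i := by
      rintro _ ⟨m, rfl⟩
      have hmem : momentPoint (r ‖w m‖) ∈ amoeba p := by
        refine mem_amoeba_iff.mpr ⟨fun a => c a * w m ^ k a, ?_, ?_, ?_⟩
        · intro h
          have h1 := congrFun h j
          simp [c, k, hji, hlj.symm] at h1
        · rw [← eval_curvePoly]
          exact Polynomial.isRoot_of_mem_roots (hwq m)
        · simp [r]
      refine ⟨hmem, amoeba_subset hmem, ?_⟩
      simp [momentPoint, hri]
    have h1 := Set.encard_le_encard hrange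
    rw [← Set.image_univ, hinj.encard_image, Set.encard_univ] at h1
    simpa using h1

/-- If every term of `p` dominates somewhere, then the amoeba is as expected. -/
theorem hasExpectedAmoeba_of_nonempty {p : MvPolynomial (Fin 3) ℂ} {d : ℕ}
    (hp : p.IsHomogeneous d)
    (hdom : ∀ I : Fin 3 →₀ ℕ, I.degree = d → (dominanceRegion p I).Nonempty) :
    HasExpectedAmoeba d p :=
  ⟨encard_holes hp hdom, encard_amoeba_inter_edge hp hdom⟩

/-! ### From convexity with margin to dominance -/

theorem mem_finsuppAntidiag_univ {d : ℕ} {I : Fin 3 →₀ ℕ} :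
    I ∈ Finset.finsuppAntidiag (Finset.univ : Finset (Fin 3)) d ↔ I.degree = d := by
  simp [Finset.mem_finsuppAntidiag, Finsupp.degree_eq_sum]

theorem latticePoint_injective : Function.Injective latticePoint := by
  intro I J h
  ext i
  have := congrFun h i
  simpa [latticePoint] using this

theorem sum_latticePoint {d : ℕ} {I : Fin 3 →₀ ℕ} (hI : I.degree = d) :
    ∑ i, latticePoint I i = d := by
  rw [← hI, Finsupp.degree_eq_sum]
  simp [latticePoint]

theorem IsNewtonTriangulation.exists_of_mem {d : ℕ}
    {Z : Geometry.SimplicialComplex ℝ (Fin 3 → ℝ)} (hZ : IsNewtonTriangulation d Z)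
    {s : Finset (Fin 3 → ℝ)} (hs : s ∈ Z.faces) {x : Fin 3 → ℝ} (hx : x ∈ s) :
    ∃ I : Fin 3 →₀ ℕ, I.degree = d ∧ x = latticePoint I := by
  have h : x ∈ Z.vertices :=
    Z.down_closed hs (Finset.singleton_subset_iff.mpr hx) (Finset.singleton_nonempty x)
  rw [hZ.vertices_eq] at h
  exact h

/-- The lattice points of the Newton polygon. -/
noncomputable def latticePoints (d : ℕ) : Finset (Fin 3 → ℝ) :=
  (Finset.finsuppAntidiag (Finset.univ : Finset (Fin 3)) d).image latticePoint

theorem IsNewtonTriangulation.subset_latticePoints {d : ℕ}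
    {Z : Geometry.SimplicialComplex ℝ (Fin 3 → ℝ)} (hZ : IsNewtonTriangulation d Z)
    {s : Finset (Fin 3 → ℝ)} (hs : s ∈ Z.faces) : s ⊆ latticePoints d := by
  intro x hx
  obtain ⟨I, hI, rfl⟩ := hZ.exists_of_mem hs hx
  exact Finset.mem_image_of_mem _ (mem_finsuppAntidiag_univ.mpr hI)

theorem IsNewtonTriangulation.exists_facet {d : ℕ}
    {Z : Geometry.SimplicialComplex ℝ (Fin 3 → ℝ)} (hZ : IsNewtonTriangulation d Z)
    {I : Fin 3 →₀ ℕ} (hI : I.degree = d) : ∃ s ∈ Z.facets, latticePoint I ∈ s := by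
  have hv : latticePoint I ∈ Z.vertices := by
    rw [hZ.vertices_eq]
    exact ⟨I, hI, rfl⟩
  have hfin : {s | s ∈ Z.faces}.Finite :=
    (latticePoints d).powerset.finite_toSet.subset fun s hs =>
      Finset.mem_coe.mpr (Finset.mem_powerset.mpr (hZ.subset_latticePoints hs))
  obtain ⟨s, hs, hmax⟩ := hfin.exists_le_maximal (a := {latticePoint I}) hv
  refine ⟨s, ⟨hmax.1, fun t ht hst => ?_⟩, hs (Finset.mem_singleton_self _)⟩
  exact Finset.Subset.antisymm hst (hmax.2 ht hst)

/-- Affinely independent points of a plane that misses the origin are linearly independent. -/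
theorem linearIndependent_of_affineIndependent {ι : Type*} [Fintype ι] {v : ι → Fin 3 → ℝ}
    (hv : AffineIndependent ℝ v) {a : ℝ} (ha : a ≠ 0) (hsum : ∀ x, ∑ i, v x i = a) :
    LinearIndependent ℝ v := by
  rw [Fintype.linearIndependent_iff]
  intro g hg x
  refine (affineIndependent_iff.mp hv) Finset.univ g ?_ hg x (Finset.mem_univ x)
  have h1 : ∑ i, (∑ x, g x • v x) i = 0 := by
    rw [hg]
    simp
  simp only [Finset.sum_apply, Pi.smul_apply, smul_eq_mul] at h1
  rw [Finset.sum_comm] at h1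
  simp only [← Finset.mul_sum, hsum, ← Finset.sum_mul] at h1
  exact (mul_eq_zero.mp h1).resolve_right ha

theorem exists_linearMap_eq_on_family {ι : Type*} {v : ι → Fin 3 → ℝ}
    (hv : LinearIndependent ℝ v) (g : ι → ℝ) : ∃ ψ : (Fin 3 → ℝ) →ₗ[ℝ] ℝ, ∀ x, ψ (v x) = g x := by
  obtain ⟨ψ, hψ⟩ := LinearMap.exists_extend ((Finsupp.linearCombination ℝ g) ∘ₗ hv.repr)
  refine ⟨ψ, fun x => ?_⟩
  have h1 := LinearMap.congr_fun hψ ⟨v x, Submodule.subset_span ⟨x, rfl⟩⟩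
  simp only [LinearMap.comp_apply, Submodule.subtype_apply] at h1
  rw [h1, hv.repr_eq_single x _ rfl]
  simp

/-- The vertices of a face lie in a plane missing the origin, as `d ≥ 1`, so they are linearly
independent and values on them can be prescribed. Subtracting a positive multiple of `ψ` tilts a
supporting form down at every vertex of `s` except `x`. -/
theorem IsNewtonTriangulation.exists_linearMap {d : ℕ} (hd : 1 ≤ d)
    {Z : Geometry.SimplicialComplex ℝ (Fin 3 → ℝ)} (hZ : IsNewtonTriangulation d Z)
    {s : Finset (Fin 3 → ℝ)} (hs : s ∈ Z.faces) (x : Fin 3 → ℝ) :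
    ∃ ψ : (Fin 3 → ℝ) →ₗ[ℝ] ℝ, ∀ y ∈ s, ψ y = if y = x then 0 else 1 := by
  have hli : LinearIndependent ℝ ((↑) : s → Fin 3 → ℝ) := by
    refine linearIndependent_of_affineIndependent (Z.indep hs) (a := d) (by positivity) fun y => ?_
    obtain ⟨I, hI, h⟩ := hZ.exists_of_mem hs y.2
    rw [h]
    exact sum_latticePoint hI
  obtain ⟨ψ, hψ⟩ := exists_linearMap_eq_on_family hli fun y => if (y : Fin 3 → ℝ) = x then 0 else 1
  exact ⟨ψ, fun y hy => hψ ⟨y, hy⟩⟩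

/-- The linear forms that separate a vertex of a facet from the other vertices are bounded in
terms of the degree. -/
theorem exists_bound_linearMap (d : ℕ) (hd : 1 ≤ d) :
    ∃ C : ℝ, 0 ≤ C ∧ ∀ Z : Geometry.SimplicialComplex ℝ (Fin 3 → ℝ), IsNewtonTriangulation d Z →
      ∀ s ∈ Z.faces, ∀ x ∈ s, ∃ ψ : (Fin 3 → ℝ) →ₗ[ℝ] ℝ,
        (∀ y ∈ s, ψ y = if y = x then 0 else 1) ∧ ∀ y ∈ latticePoints d, |ψ y| ≤ C := by
  -- The constant is chosen for each pair of a point set and a point, without reference to `Z`. Only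
  -- finitely many pairs consist of lattice points, so summing gives a bound in `d` alone.
  have h : ∀ a : Finset (Fin 3 → ℝ) × (Fin 3 → ℝ), ∃ C : ℝ, 0 ≤ C ∧
      ((∃ ψ : (Fin 3 → ℝ) →ₗ[ℝ] ℝ, ∀ y ∈ a.1, ψ y = if y = a.2 then 0 else 1) →
      ∃ ψ : (Fin 3 → ℝ) →ₗ[ℝ] ℝ, (∀ y ∈ a.1, ψ y = if y = a.2 then 0 else 1) ∧
        ∀ y ∈ latticePoints d, |ψ y| ≤ C) := by
    intro a
    by_cases hψ : ∃ ψ : (Fin 3 → ℝ) →ₗ[ℝ] ℝ, ∀ y ∈ a.1, ψ y = if y = a.2 then 0 else 1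
    · obtain ⟨ψ, hψ⟩ := hψ
      exact ⟨∑ y ∈ latticePoints d, |ψ y|, Finset.sum_nonneg fun _ _ => abs_nonneg _, fun _ =>
        ⟨ψ, hψ, fun y hy =>
          Finset.single_le_sum (f := fun y => |ψ y|) (fun _ _ => abs_nonneg _) hy⟩⟩
    · exact ⟨0, le_rfl, fun h => absurd h hψ⟩
  choose C hC0 hC using h
  refine ⟨∑ a ∈ (latticePoints d).powerset ×ˢ latticePoints d, C a,
    Finset.sum_nonneg fun a _ => hC0 a, fun Z hZ s hs x hx => ?_⟩
  obtain ⟨ψ, hψ, hb⟩ := hC (s, x) (hZ.exists_linearMap hd hs x)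
  have hsub := hZ.subset_latticePoints hs
  refine ⟨ψ, hψ, fun y hy => (hb y hy).trans ?_⟩
  exact Finset.single_le_sum (f := C) (fun a _ => hC0 a)
    (Finset.mem_product.mpr ⟨Finset.mem_powerset.mpr hsub, hsub hx⟩)

theorem apply_latticePoint (l : (Fin 3 → ℝ) →ₗ[ℝ] ℝ) (I : Fin 3 →₀ ℕ) :
    l (latticePoint I) = ∑ i, (I i : ℝ) * l (Pi.single i 1) := by
  conv_lhs => rw [← LinearMap.sum_single_apply (fun _ => ℝ) (latticePoint I), map_sum]
  refine Finset.sum_congr rfl fun i _ => ?_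
  have h : (Pi.single i (latticePoint I i) : Fin 3 → ℝ) = (I i : ℝ) • Pi.single i 1 := by
    rw [← Pi.single_smul, smul_eq_mul, mul_one]
    rfl
  rw [h, map_smul, smul_eq_mul]

/-- A linear form that supports the weights of `p` at `I` with a large margin gives a point where
the `I`-th term dominates. -/
theorem dominanceRegion_nonempty_of_margin {p : MvPolynomial (Fin 3) ℂ} {d : ℕ}
    (hp : p.IsHomogeneous d) {I : Fin 3 →₀ ℕ} (hI : p.coeff I ≠ 0) {M : ℝ}
    (hM : (Finset.finsuppAntidiag (Finset.univ : Finset (Fin 3)) d).card * Real.exp (-M) < 1)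
    {l : (Fin 3 → ℝ) →ₗ[ℝ] ℝ} (hl : l (latticePoint I) = -Real.log ‖p.coeff I‖)
    (hlJ : ∀ J : Fin 3 →₀ ℕ, J.degree = d → J ≠ I →
      l (latticePoint J) + M ≤ -Real.log ‖p.coeff J‖) :
    (dominanceRegion p I).Nonempty := by
  -- With these logarithmic radii the `J`-th term has logarithm `l(J) + log |a_J|`: it is `0` at `I`
  -- and at most `-M` at the other terms.
  refine ⟨fun i => l (Pi.single i 1), mem_dominanceRegion_iff.mpr ?_⟩
  have hI0 : 0 < ‖p.coeff I‖ := norm_pos_iff.mpr hI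
  have hterm : ∀ J ∈ p.support.erase I,
      ‖p.coeff J‖ * Real.exp (∑ i, ((J i : ℝ) - I i) * l (Pi.single i 1)) ≤
        Real.exp (-M) * ‖p.coeff I‖ := by
    intro J hJ
    have hJ0 : 0 < ‖p.coeff J‖ :=
      norm_pos_iff.mpr (MvPolynomial.mem_support_iff.mp (Finset.mem_of_mem_erase hJ))
    have h1 := hlJ J (degree_of_mem_support hp (Finset.mem_of_mem_erase hJ))
      (Finset.ne_of_mem_erase hJ)
    simp only [sub_mul, Finset.sum_sub_distrib, ← apply_latticePoint]
    conv_lhs => rw [← Real.exp_log hJ0, ← Real.exp_add]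
    conv_rhs => rw [← Real.exp_log hI0, ← Real.exp_add]
    rw [Real.exp_le_exp]
    linarith
  have hcard : p.support.erase I ⊆ Finset.finsuppAntidiag (Finset.univ : Finset (Fin 3)) d :=
    fun J hJ => mem_finsuppAntidiag_univ.mpr
      (degree_of_mem_support hp (Finset.mem_of_mem_erase hJ))
  refine (Finset.sum_le_card_nsmul _ _ _ hterm).trans_lt ?_
  rw [nsmul_eq_mul, ← mul_assoc]
  refine mul_lt_of_lt_one_left hI0 (lt_of_le_of_lt ?_ hM)
  exact mul_le_mul_of_nonneg_right (by exact_mod_cast Finset.card_le_card hcard)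
    (Real.exp_pos _).le

theorem exists_hasExpectedAmoeba_of_isNear (d : ℕ) (hd : 1 ≤ d) :
    ∃ R : ℝ, 0 < R ∧ ∀ p : MvPolynomial (Fin 3) ℂ,
      IsNearLargeComplexLimit d R p → HasExpectedAmoeba d p := by
  obtain ⟨C, hC0, hC⟩ := exists_bound_linearMap d hd
  set n : ℕ := (Finset.finsuppAntidiag (Finset.univ : Finset (Fin 3)) d).card
  set M : ℝ := Real.log (n + 1)
  have hM0 : 0 ≤ M := Real.log_nonneg (by simp)
  have hM : n * Real.exp (-M) < 1 := by
    rw [Real.exp_neg, Real.exp_log (by positivity), ← div_eq_mul_inv, div_lt_one (by positivity)]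
    linarith
  -- Tilting by `M • ψ` creates a gap `M` at the other vertices of `s` and costs at most `M * C`
  -- elsewhere, where a gap `M` must remain. The final `1` only ensures positivity.
  refine ⟨M * (C + 1) + 1, by positivity, ?_⟩
  rintro p ⟨hp, hne, Z, hZ, hconv⟩
  refine hasExpectedAmoeba_of_nonempty hp fun I hI => ?_
  obtain ⟨s, hs, hIs⟩ := hZ.exists_facet hI
  obtain ⟨l, hl⟩ := hconv s hs
  obtain ⟨ψ, hψ, hψC⟩ := hC Z hZ s hs.1 _ hIs
  refine dominanceRegion_nonempty_of_margin hp (hne I hI) hM (l := l - M • ψ) ?_ ?_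
  · simp [(hl I hI).1 hIs, hψ _ hIs]
  · intro J hJ hJI
    simp only [LinearMap.sub_apply, LinearMap.smul_apply, smul_eq_mul]
    by_cases hJs : latticePoint J ∈ s
    · rw [(hl J hJ).1 hJs, hψ _ hJs, if_neg fun h => hJI (latticePoint_injective h)]
      linarith
    · have h1 := (hl J hJ).2 hJs
      have h2 := hψC _ (Finset.mem_image_of_mem latticePoint (mem_finsuppAntidiag_univ.mpr hJ))
      have h3 := mul_le_mul_of_nonneg_left (neg_le_of_abs_le h2) hM0
      linarith

/-! ### The one-parameter family -/

theorem coeff_weightedPoly {d : ℕ} {c : (Fin 3 →₀ ℕ) → ℂ} {w : (Fin 3 →₀ ℕ) → ℝ} {t : ℝ}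
    {I : Fin 3 →₀ ℕ} (hI : I.degree = d) :
    (weightedPoly d c w t).coeff I = c I * ((t ^ w I : ℝ) : ℂ) := by
  rw [weightedPoly, MvPolynomial.coeff_sum, Finset.sum_eq_single I]
  · simp
  · intro J _ hJ
    simp [hJ]
  · intro h
    exact absurd (mem_finsuppAntidiag_univ.mpr hI) h

theorem isHomogeneous_weightedPoly (d : ℕ) (c : (Fin 3 →₀ ℕ) → ℂ) (w : (Fin 3 →₀ ℕ) → ℝ) (t : ℝ) :
    (weightedPoly d c w t).IsHomogeneous d :=
  MvPolynomial.IsHomogeneous.sum _ _ _ fun _ hI =>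
    MvPolynomial.isHomogeneous_monomial _ (mem_finsuppAntidiag_univ.mp hI)

-- At the logarithmic radii `-log t * l(e_i)`, dominance reads `∑ |c_J| t ^ (w_J - l(J)) < |c_I|`,
-- summed over `J ≠ I`. The exponents are positive, so the left side tends to `0` with `t`.
open Filter Topology in
theorem eventually_dominanceRegion_nonempty {d : ℕ} {c : (Fin 3 →₀ ℕ) → ℂ}
    {w : (Fin 3 →₀ ℕ) → ℝ} {I : Fin 3 →₀ ℕ} (hI : I.degree = d) (hcI : c I ≠ 0)
    {l : (Fin 3 → ℝ) →ₗ[ℝ] ℝ} (hl : l (latticePoint I) = w I)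
    (hlJ : ∀ J : Fin 3 →₀ ℕ, J.degree = d → J ≠ I → l (latticePoint J) < w J) :
    ∀ᶠ t in 𝓝[>] (0 : ℝ), (dominanceRegion (weightedPoly d c w t) I).Nonempty := by
  set E := Finset.finsuppAntidiag (Finset.univ : Finset (Fin 3)) d
  have hlim : Tendsto (fun t : ℝ => ∑ J ∈ E.erase I, ‖c J‖ * t ^ (w J - l (latticePoint J)))
      (𝓝[>] 0) (𝓝 0) := by
    suffices h : Tendsto (fun t : ℝ => ∑ J ∈ E.erase I, ‖c J‖ * t ^ (w J - l (latticePoint J)))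
        (𝓝[>] 0) (𝓝 (∑ _J ∈ E.erase I, 0)) by simpa using h
    refine tendsto_finsetSum _ fun J hJ => ?_
    have hpos : 0 < w J - l (latticePoint J) := sub_pos.mpr (hlJ J
      (mem_finsuppAntidiag_univ.mp (Finset.mem_of_mem_erase hJ)) (Finset.ne_of_mem_erase hJ))
    have h1 := (Real.continuousAt_rpow_const 0 _ (Or.inr hpos.le)).tendsto.const_mul ‖c J‖
    rw [Real.zero_rpow hpos.ne', mul_zero] at h1
    exact h1.mono_left nhdsWithin_le_nhds
  filter_upwards [hlim.eventually_lt_const (norm_pos_iff.mpr hcI), self_mem_nhdsWithin] with t ht ht0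
  have ht0' : 0 < t := ht0
  refine ⟨fun i => -Real.log t * l (Pi.single i 1), mem_dominanceRegion_iff.mpr ?_⟩
  have hnorm : ∀ J : Fin 3 →₀ ℕ, J.degree = d →
      ‖(weightedPoly d c w t).coeff J‖ = ‖c J‖ * t ^ w J := by
    intro J hJ
    rw [coeff_weightedPoly hJ, norm_mul, Complex.norm_real,
      Real.norm_of_nonneg (Real.rpow_nonneg ht0'.le _)]
  have hterm : ∀ J ∈ E.erase I, ‖(weightedPoly d c w t).coeff J‖ *
      Real.exp (∑ i, ((J i : ℝ) - I i) * (-Real.log t * l (Pi.single i 1))) =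
      (‖c J‖ * t ^ (w J - l (latticePoint J))) * t ^ w I := by
    intro J hJ
    have h1 : ∑ i, ((J i : ℝ) - I i) * (-Real.log t * l (Pi.single i 1)) =
        Real.log t * (w I - l (latticePoint J)) := by
      rw [← hl, apply_latticePoint, apply_latticePoint, ← Finset.sum_sub_distrib, Finset.mul_sum]
      exact Finset.sum_congr rfl fun i _ => by ring
    rw [h1, ← Real.rpow_def_of_pos ht0',
      hnorm J (mem_finsuppAntidiag_univ.mp (Finset.mem_of_mem_erase hJ)), mul_assoc, mul_assoc,
      ← Real.rpow_add ht0', ← Real.rpow_add ht0']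
    congr 2
    ring
  have hsub : (weightedPoly d c w t).support.erase I ⊆ E.erase I := Finset.erase_subset_erase _
    fun J hJ => mem_finsuppAntidiag_univ.mpr
      (degree_of_mem_support (isHomogeneous_weightedPoly d c w t) hJ)
  refine (Finset.sum_le_sum_of_subset_of_nonneg hsub fun J _ _ => by positivity).trans_lt ?_
  rw [Finset.sum_congr rfl hterm, ← Finset.sum_mul, hnorm I hI]
  exact mul_lt_mul_of_pos_right ht (Real.rpow_pos_of_pos ht0' _)

-- Tilting by `ε • ψ` makes the inequality strict at the other vertices of `s`; the finitely many
-- strict inequalities outside `s` survive for small `ε`.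
open Filter Topology in
theorem IsStrictlyConvexFor.exists_linearMap {d : ℕ} (hd : 1 ≤ d)
    {Z : Geometry.SimplicialComplex ℝ (Fin 3 → ℝ)} (hZ : IsNewtonTriangulation d Z)
    {w : (Fin 3 →₀ ℕ) → ℝ} (hw : IsStrictlyConvexFor d Z w) {I : Fin 3 →₀ ℕ} (hI : I.degree = d) :
    ∃ l : (Fin 3 → ℝ) →ₗ[ℝ] ℝ, l (latticePoint I) = w I ∧
      ∀ J : Fin 3 →₀ ℕ, J.degree = d → J ≠ I → l (latticePoint J) < w J := by
  obtain ⟨s, hs, hIs⟩ := hZ.exists_facet hI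
  obtain ⟨l, hl⟩ := hw s hs
  obtain ⟨ψ, hψ⟩ := hZ.exists_linearMap hd hs.1 (latticePoint I)
  have hev : ∀ J ∈ Finset.finsuppAntidiag (Finset.univ : Finset (Fin 3)) d, ∀ᶠ ε in 𝓝[>] (0 : ℝ),
      J ≠ I → (l - ε • ψ) (latticePoint J) < w J := by
    intro J hJ
    have hJ := mem_finsuppAntidiag_univ.mp hJ
    simp only [LinearMap.sub_apply, LinearMap.smul_apply, smul_eq_mul]
    by_cases hJs : latticePoint J ∈ s
    · filter_upwards [self_mem_nhdsWithin] with ε hε hJI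
      rw [(hl J hJ).1 hJs, hψ _ hJs, if_neg fun h => hJI (latticePoint_injective h)]
      have : 0 < ε := hε
      linarith
    · have hcont : Tendsto (fun ε : ℝ => l (latticePoint J) - ε * ψ (latticePoint J)) (𝓝[>] 0)
          (𝓝 (l (latticePoint J) - 0 * ψ (latticePoint J))) :=
        ((by fun_prop : Continuous fun ε : ℝ =>
          l (latticePoint J) - ε * ψ (latticePoint J)).tendsto 0).mono_left nhdsWithin_le_nhds
      have h1 := (hl J hJ).2 hJs
      filter_upwards [hcont.eventually_lt_const (by simpa using h1)] with ε hε _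
      exact hε
  obtain ⟨ε, hε⟩ := ((Filter.eventually_all_finset _).mpr hev).exists
  refine ⟨l - ε • ψ, ?_, fun J hJ hJI => hε J (mem_finsuppAntidiag_univ.mpr hJ) hJI⟩
  simp [(hl I hI).1 hIs, hψ _ hIs]

open Filter Topology in
theorem exists_hasExpectedAmoeba_weightedPoly {d : ℕ} (hd : 1 ≤ d)
    {Z : Geometry.SimplicialComplex ℝ (Fin 3 → ℝ)} {w : (Fin 3 →₀ ℕ) → ℝ}
    {c : (Fin 3 →₀ ℕ) → ℂ} (hZ : IsNewtonTriangulation d Z) (hw : IsStrictlyConvexFor d Z w)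
    (hc : ∀ I : Fin 3 →₀ ℕ, I.degree = d → c I ≠ 0) :
    ∃ t₀ : ℝ, 0 < t₀ ∧ ∀ t : ℝ, 0 < t → t < t₀ →
      HasExpectedAmoeba d (weightedPoly d c w t) := by
  have hev : ∀ I ∈ Finset.finsuppAntidiag (Finset.univ : Finset (Fin 3)) d,
      ∀ᶠ t in 𝓝[>] (0 : ℝ), (dominanceRegion (weightedPoly d c w t) I).Nonempty := by
    intro I hI
    have hI := mem_finsuppAntidiag_univ.mp hI
    obtain ⟨l, hl, hlJ⟩ := hw.exists_linearMap hd hZ hI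
    exact eventually_dominanceRegion_nonempty hI (hc I hI) hl hlJ
  have hall := (Filter.eventually_all_finset _).mpr hev
  obtain ⟨t₀, ht₀, h⟩ := mem_nhdsGT_iff_exists_Ioo_subset.mp hall
  refine ⟨t₀, ht₀, fun t h0 h1 => ?_⟩
  exact hasExpectedAmoeba_of_nonempty (isHomogeneous_weightedPoly d c w t) fun I hI =>
    h ⟨h0, h1⟩ I (mem_finsuppAntidiag_univ.mpr hI)

end AmoebaLCL

theorem mainTheorem7 (d : ℕ) (hd : 1 ≤ d) :
    (∃ R : ℝ, 0 < R ∧ ∀ p : MvPolynomial (Fin 3) ℂ,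
      AmoebaLCL.IsNearLargeComplexLimit d R p → AmoebaLCL.HasExpectedAmoeba d p) ∧
    (∀ (Z : Geometry.SimplicialComplex ℝ (Fin 3 → ℝ)) (w : (Fin 3 →₀ ℕ) → ℝ)
      (c : (Fin 3 →₀ ℕ) → ℂ),
      AmoebaLCL.IsNewtonTriangulation d Z → AmoebaLCL.IsStrictlyConvexFor d Z w →
      (∀ I : Fin 3 →₀ ℕ, I.degree = d → c I ≠ 0) →
      ∃ t₀ : ℝ, 0 < t₀ ∧ ∀ t : ℝ, 0 < t → t < t₀ →
        AmoebaLCL.HasExpectedAmoeba d (AmoebaLCL.weightedPoly d c w t)) :=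
  ⟨AmoebaLCL.exists_hasExpectedAmoeba_of_isNear d hd, fun _ _ _ hZ hw hc =>
    AmoebaLCL.exists_hasExpectedAmoeba_weightedPoly hd hZ hw hc⟩
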